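/- Conventions. The height $\mathrm{Ht}(P)$ of a poset $P$ is the supremum of the cardinalities of its chains (a cardinal number). For a semigroup $S$, $S^1$ is $S$ with an identity adjoined if necessary; $\mathscr L,\mathscr R,\mathscr J$ are Green's equivalences ($x\,\mathscr L\,y\iff S^1x=S^1y$, $x\,\mathscr R\,y\iff xS^1=yS^1$, $x\,\mathscr J\,y\iff S^1xS^1=S^1yS^1$) and $\mathscr H=\mathscr L\cap\mathscr R$. $\mathscr J$-classes are ordered by $J_x\le J_y\iff x\in S^1yS^1$. A $\mathscr J$-class $J$ is stable if for all $x\in J$, $s\in S^1$: $x\,\mathscr J\,sx\Rightarrow x\,\mathscr L\,sx$ and $x\,\mathscr J\,xs\Rightarrow x\,\mathscr R\,xs$; $S$ is stable if all its $\mathscr J$-classes are. For an $\mathscr H$-class $H$, its Schützenberger group $\Gamma(H)$ is the group of all permutations of $H$ of the form $x\mapsto xt$ with $t\in S^1$, $Ht= H$. $\mathrm{NSub}(\Gamma)$ is the lattice of normal subgroups of a group $\Gamma$, and $\mathrm{Cong}(S)$ is the lattice of congruences of $S$. Congruences of a left act, right act or biact are the equivalence relations compatible with all its operations, ordered by inclusion;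 such a congruence is maximal if it is maximal among those different from the universal relation $\nabla$. For $X\subseteq S$ write $\mathscr H_X=\mathscr H\cap(X\times X)$ and $\nabla_X=X\times X$. For a $\mathscr J$-class $J$ let ${}^S\overline J{}^S$ be the $(S,S)$-biact on $J\cup\{0\}$ in which $s\cdot x=sx$ if $x,sx\in J$ and $s\cdot x=0$ otherwise, and $x\cdot s=xs$ if $x,xs\in J$ and $x\cdot s=0$ otherwise. A stable $\mathscr J$-class $J$ is $\mathscr H$-separable if $\mathscr H_J\cup\{(0,0)\}$ is the unique maximal congruence of ${}^S\overline J{}^S$. If $J$ is a minimal $\mathscr J$-class, then ${}^S\!J^S$ is the $(S,S)$-biact $J$ under left and right multiplication by elements of $S$; if $J$ is moreover stable, then every $\mathscr L$-class $L\subseteq J$ is a left $S$-act ${}^S\!L$ under left multiplication and every $\mathscr R$-class $R\subseteq J$ is a right $S$-act $R^S$ under right multiplication. Theorem. Let $S$ be a stable semigroup with finitely many $\mathscr J$-classes $J_1,\dots,J_n$ (listed without repetition), with $J_1$ minimal. For each $r=1,\dots,n$ let $\Gamma_r$ be the Schützenberger group of any $\mathscr H$-class contained in $J_r$. Suppose that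 $J_2,\dots,J_n$ are all $\mathscr H$-separable. (a) Then $$\mathrm{Ht}(\mathrm{Cong}(S))=\mathrm{Ht}(\mathrm{Cong}({}^S\!J_1^S))+\sum_{r=2}^n\mathrm{Ht}(\mathrm{NSub}(\Gamma_r)).$$ (b) Suppose in addition that for some $\mathscr L$-class $L'\subseteq J_1$ either $\mathscr H_{L'}$ is the unique maximal congruence of ${}^S\!L'$ or $\mathscr H_{L'}=\nabla_{L'}$, and that for some $\mathscr R$-class $R'\subseteq J_1$ either $\mathscr H_{R'}$ is the unique maximal congruence of $R'^S$ or $\mathscr H_{R'}=\nabla_{R'}$. Then for every $\mathscr L$-class $L\subseteq J_1$ and every $\mathscr R$-class $R\subseteq J_1$, $$\mathrm{Ht}(\mathrm{Cong}(S))=\sum_{r=1}^n\mathrm{Ht}(\mathrm{NSub}(\Gamma_r))+\begin{cases}0&\text{if }\mathscr H_L=\nabla_L\text{ and }\mathscr H_R=\nabla_R,\\1&\text{if }\mathscr H_L=\nabla_L\text{ and }\mathscr H_R\ne\nabla_R,\\1&\text{if }\mathscr H_L\ne\nabla_L\text{ and }\mathscr H_R=\nabla_R,\\2&\text{if }\mathscr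 H_L\ne\nabla_L\text{ and }\mathscr H_R\ne\nabla_R.\end{cases}$$ -/

import Mathlib

universe u v

namespace GreenHeight

/-- The height of a poset: the supremum of the cardinalities of its chains, as a cardinal number.
The family of these cardinals is bounded by the cardinality of `P`, so the supremum is genuine. -/
noncomputable def height (P : Type u) [PartialOrder P] : Cardinal.{u} :=
  ⨆ c : {c : Set P // IsChain (· ≤ ·) c}, Cardinal.mk c.1

section UnaryAlgebras

variable {ι : Type v} {A : Type u}

/-- The congruences of the unary algebra `A` with basic operations `op i`, ordered by inclusion
(as a set of elements of the lattice of equivalence relations). -/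
def unaryCong (op : ι → A → A) : Set (Setoid A) :=
  {σ | ∀ (i : ι) (a b : A), σ a b → σ (op i a) (op i b)}

/-- `τ` is the unique maximal congruence: the maximal elements among the congruences different
from the universal relation are precisely `τ`. -/
def IsUniqueMaximalCong (op : ι → A → A) (τ : Setoid A) : Prop :=
  ∀ σ : Setoid A, Maximal (fun ρ : Setoid A => ρ ∈ unaryCong op ∧ ρ ≠ ⊤) σ ↔ σ = τ

/-- The subalgebra on a subset closed under all the operations. -/
def subOp (op : ι → A → A) (X : Set A) (hX : ∀ (i : ι) (a : A), a ∈ X → op i a ∈ X) :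
    ι → X → X :=
  fun i a => ⟨op i a, hX i a a.2⟩

open Classical in
/-- The operations of the principal factor `X ∪ {0}` of a subset `X`, where `none` plays the role
of `0`: the value is the original one if it stays in `X`, and `0` otherwise. -/
noncomputable def principalFactorOp (op : ι → A → A) (X : Set A) :
    ι → Option X → Option X :=
  fun i x => x.bind fun a => if h : op i a ∈ X then some ⟨op i a, h⟩ else none

/-- The equivalence `σ ∪ {(0, 0)}` on `X ∪ {0}`. -/
def extendZero {X : Type u} (σ : Setoid X) : Setoid (Option X) where
  r x y := Option.Rel (fun a b => σ a b) x y
  iseqv :=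
    { refl := fun x => by
        cases x with
        | none => exact .none
        | some a => exact .some (σ.refl' a)
      symm := fun h => by
        cases h with
        | none => exact .none
        | some h => exact .some (σ.symm' h)
      trans := fun h k => by
        cases h with
        | none => exact k
        | some h =>
          cases k with
          | some k => exact .some (σ.trans' h k) }

end UnaryAlgebras

theorem rel_of_mem_class {α : Type u} {σ : Setoid α} {X : Set α} (hX : X ∈ σ.classes) {x y : α}
    (hx : x ∈ X) (hy : y ∈ X) : σ x y := by
  obtain ⟨z, rfl⟩ := hX
  exact σ.trans' hx (σ.symm' hy)

theorem mem_class_of_rel {α : Type u} {σ : Setoid α} {X : Set α} (hX : X ∈ σ.classes) {x y : α}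
    (hx : x ∈ X) (h : σ x y) : y ∈ X := by
  obtain ⟨z, rfl⟩ := hX
  exact σ.trans' (σ.symm' h) hx

section Green

variable {S : Type u} [Semigroup S]

/-- `x ≤_L y`, i.e. `x ∈ S¹ y`. Here and below `WithOne S` is used for `S¹`; if `S` already has an
identity then the new identity acts on `S` as the old one, so nothing changes. -/
def LeL (x y : S) : Prop := ∃ s : WithOne S, (x : WithOne S) = s * (y : WithOne S)

/-- `x ≤_R y`, i.e. `x ∈ y S¹`. -/
def LeR (x y : S) : Prop := ∃ t : WithOne S, (x : WithOne S) = (y : WithOne S) * t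

/-- `x ≤_J y`, i.e. `x ∈ S¹ y S¹`. -/
def LeJ (x y : S) : Prop :=
  ∃ s t : WithOne S, (x : WithOne S) = s * (y : WithOne S) * t

theorem LeL.refl (x : S) : LeL x x := ⟨1, by simp⟩

theorem LeR.refl (x : S) : LeR x x := ⟨1, by simp⟩

theorem LeJ.refl (x : S) : LeJ x x := ⟨1, 1, by simp⟩

theorem LeL.trans {x y z : S} (h : LeL x y) (k : LeL y z) : LeL x z := by
  obtain ⟨s, hs⟩ := h
  obtain ⟨t, ht⟩ := k
  exact ⟨s * t, by rw [hs, ht, mul_assoc]⟩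

theorem LeR.trans {x y z : S} (h : LeR x y) (k : LeR y z) : LeR x z := by
  obtain ⟨s, hs⟩ := h
  obtain ⟨t, ht⟩ := k
  exact ⟨t * s, by rw [hs, ht, mul_assoc]⟩

theorem LeJ.trans {x y z : S} (h : LeJ x y) (k : LeJ y z) : LeJ x z := by
  obtain ⟨s, s', hs⟩ := h
  obtain ⟨t, t', ht⟩ := k
  exact ⟨s * t, t' * s', by rw [hs, ht]; simp only [mul_assoc]⟩

variable (S) in
/-- Green's relation `L`. -/
def greenL : Setoid S where
  r x y := LeL x y ∧ LeL y x
  iseqv := ⟨fun x => ⟨.refl x, .refl x⟩, fun h => ⟨h.2, h.1⟩,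
    fun h k => ⟨h.1.trans k.1, k.2.trans h.2⟩⟩

variable (S) in
/-- Green's relation `R`. -/
def greenR : Setoid S where
  r x y := LeR x y ∧ LeR y x
  iseqv := ⟨fun x => ⟨.refl x, .refl x⟩, fun h => ⟨h.2, h.1⟩,
    fun h k => ⟨h.1.trans k.1, k.2.trans h.2⟩⟩

variable (S) in
/-- Green's relation `J`. -/
def greenJ : Setoid S where
  r x y := LeJ x y ∧ LeJ y x
  iseqv := ⟨fun x => ⟨.refl x, .refl x⟩, fun h => ⟨h.2, h.1⟩,
    fun h k => ⟨h.1.trans k.1, k.2.trans h.2⟩⟩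

variable (S) in
/-- Green's relation `H`, the intersection of `L` and `R`. -/
def greenH : Setoid S := greenL S ⊓ greenR S

/-- The restriction of Green's relation `H` to a subset. -/
def restrictH (X : Set S) : Setoid X := (greenH S).comap Subtype.val

/-- Stability of a `J`-class (the conditions hold trivially for the identity of `S¹`). -/
def IsStableClass (J : Set S) : Prop :=
  ∀ x ∈ J, ∀ s : S, (greenJ S x (s * x) → greenL S x (s * x)) ∧
    (greenJ S x (x * s) → greenR S x (x * s))

variable (S) in
/-- A semigroup is stable if all its `J`-classes are stable. -/
def IsStable : Prop := ∀ J ∈ (greenJ S).classes, IsStableClass J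

/-- A minimal `J`-class: one that is minimal in the poset of `J`-classes. -/
def IsMinimalJClass (J : Set S) : Prop :=
  J ∈ (greenJ S).classes ∧ ∀ x ∈ J, ∀ y : S, LeJ y x → y ∈ J

variable (S) in
/-- `S` as a left `S`-act. -/
def leftOp : S → S → S := fun s x => s * x

variable (S) in
/-- `S` as a right `S`-act. -/
def rightOp : S → S → S := fun s x => x * s

variable (S) in
/-- `S` as an `(S, S)`-biact. -/
def biactOp : S ⊕ S → S → S := Sum.elim (leftOp S) (rightOp S)

/-- `H`-separability of a (stable) `J`-class `J`: the relation `H|_J ∪ {(0, 0)}` is the unique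
maximal congruence of the principal factor of `J`, an `(S, S)`-biact on `J ∪ {0}`. -/
def IsHSeparable (J : Set S) : Prop :=
  IsUniqueMaximalCong (principalFactorOp (biactOp S) J) (extendZero (restrictH J))

/-- A minimal `J`-class is a subact of the `(S, S)`-biact `S`. -/
theorem IsMinimalJClass.closed {J : Set S} (hJ : IsMinimalJClass J) :
    ∀ (i : S ⊕ S) (x : S), x ∈ J → biactOp S i x ∈ J := by
  rintro (s | s) x hx
  · exact hJ.2 x hx _ ⟨s, 1, by simp [biactOp, leftOp]⟩
  · exact hJ.2 x hx _ ⟨1, s, by simp [biactOp, rightOp]⟩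

/-- An `L`-class in a stable minimal `J`-class is a subact of the left `S`-act `S`. -/
theorem IsMinimalJClass.leftClosed {J : Set S} (hJ : IsMinimalJClass J) (hst : IsStable S)
    {L : Set S} (hL : L ∈ (greenL S).classes) (hLJ : L ⊆ J) :
    ∀ (s x : S), x ∈ L → leftOp S s x ∈ L := fun s x hx =>
  mem_class_of_rel hL hx ((hst J hJ.1 x (hLJ hx) s).1
    (rel_of_mem_class hJ.1 (hLJ hx) (hJ.closed (.inl s) x (hLJ hx))))

/-- An `R`-class in a stable minimal `J`-class is a subact of the right `S`-act `S`. -/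
theorem IsMinimalJClass.rightClosed {J : Set S} (hJ : IsMinimalJClass J) (hst : IsStable S)
    {R : Set S} (hR : R ∈ (greenR S).classes) (hRJ : R ⊆ J) :
    ∀ (s x : S), x ∈ R → rightOp S s x ∈ R := fun s x hx =>
  mem_class_of_rel hR hx ((hst J hJ.1 x (hRJ hx) s).2
    (rel_of_mem_class hJ.1 (hRJ hx) (hJ.closed (.inr s) x (hRJ hx))))

/-- The (right) Schützenberger group of an `H`-class `H`: all permutations of `H` of the form
`x ↦ x t` with `t ∈ S¹`, under composition. (Composing in the opposite order gives the opposite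
group, which has the same normal subgroups.) -/
def schutzenbergerGroup (H : Set S) (hH : H ∈ (greenH S).classes) :
    Subgroup (Equiv.Perm H) where
  carrier := {f | ∃ t : WithOne S, ∀ x : H, ((f x : S) : WithOne S) = ((x : S) : WithOne S) * t}
  one_mem' := ⟨1, fun x => by simp⟩
  mul_mem' := by
    rintro f g ⟨s, hs⟩ ⟨t, ht⟩
    exact ⟨t * s, fun x => by rw [Equiv.Perm.mul_apply, hs, ht, mul_assoc]⟩
  inv_mem' := by
    rintro f ⟨t, ht⟩
    obtain ⟨h, hh⟩ := hH
    have hmem : h ∈ H := by rw [hh]; exact (greenH S).refl' h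
    have hHc : H ∈ (greenH S).classes := ⟨h, hh⟩
    obtain ⟨t', ht'⟩ := (rel_of_mem_class hHc hmem (f ⟨h, hmem⟩).2).2.1
    refine ⟨t', fun z => ?_⟩
    obtain ⟨y, rfl⟩ := f.surjective z
    obtain ⟨s, hs⟩ := (rel_of_mem_class hHc y.2 hmem).1.1
    have hfh : (h : WithOne S) * t * t' = h := by
      rw [← ht ⟨h, hmem⟩, ← ht']
    have hinv : f⁻¹ (f y) = y := f.symm_apply_apply y
    rw [hinv, ht, hs, mul_assoc, mul_assoc, ← mul_assoc (h : WithOne S), hfh]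

end Green

/-- The poset (lattice) of normal subgroups of a group, under inclusion. -/
abbrev NSub (G : Type u) [Group G] : Type u := {N : Subgroup G // N.Normal}

end GreenHeight

open GreenHeight

/-!
All heights are computed by splitting lattices of congruences along a single congruence. Two facts
about posets suffice. If `P` has monotone maps to `Q` and `R` that are jointly injective on
comparable pairs, then `Ht P + 1 ≤ Ht Q + Ht R` (`height_add_one_le`). If copies of `Q` and `R` lie
in `P` one below the other, then `Ht Q + Ht R ≤ Ht P + 1` (`height_add_height_le`). Neither needs
modularity, and both hold for infinite cardinals.

*One `J`-class at a time.* If `X` is a subalgebra of a unary algebra `A`, and `A / X` is `A` with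
`X` collapsed to a point, then a congruence of `A` is determined, among those comparable to it, by
its trace on `X` and its image in `A / X`; congruences of `X` and of `A / X` lift to two consecutive
intervals. Hence `Ht (Cong A) + 1 = Ht (Cong X) + Ht (Cong (A / X))` (`height_unaryCong_extension`).
For ideals `X ⊆ X ∪ J` of `S` the quotient is the principal factor of `J`. If `J` is `H`-separable,
all its proper congruences are contained in `H`, so that its height is one more than that of the
lattice of congruences below `H` (`height_principalFactor`).

*Below `H`.* Translations inside a stable `J`-class are injective on `H`-classes, and left
translations commute with the Schützenberger group, so the congruences below `H` are exactly the
orbit relations of normal subgroups of that group, spread over `J` by translations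
(`congBelowHOrderIso`). Adding the `J`-classes one after another to the minimal ideal gives the sum
formula (`height_con`).

*The minimal ideal.* Here `H` is a congruence, which commutes with all others on each `L`-class and
on each `R`-class, and all elements are regular. A congruence is determined, among those comparable
to it, by its trace on `H` and by its products with `H` on one `L`-class and on one `R`-class
(`eq_of_infH_eq`). Under the hypotheses of the second part these products are either `H` or
universal, so each adds at most one to the height; the chain `H ⊂ R ⊂ ∇`, or `H ⊂ ∇`, shows that the
bound is attained (`height_minimal`).
-/

namespace GreenHeight

/-! ### Heights of posets -/

section Height

variable {P Q R : Type u} [PartialOrder P] [PartialOrder Q] [PartialOrder R]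

theorem mk_le_height {c : Set P} (hc : IsChain (· ≤ ·) c) : Cardinal.mk c ≤ height P :=
  le_ciSup (f := fun c : {c : Set P // IsChain (· ≤ ·) c} => Cardinal.mk c.1)
    ⟨Cardinal.mk P, by rintro _ ⟨c, rfl⟩; exact Cardinal.mk_set_le c.1⟩ ⟨c, hc⟩

theorem height_le {κ : Cardinal.{u}}
    (h : ∀ c : Set P, IsChain (· ≤ ·) c → Cardinal.mk c ≤ κ) : height P ≤ κ :=
  have : Nonempty {c : Set P // IsChain (· ≤ ·) c} := ⟨⟨∅, Set.pairwise_empty _⟩⟩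
  ciSup_le fun c => h c.1 c.2

theorem height_le_mk : height P ≤ Cardinal.mk P := height_le fun c _ => Cardinal.mk_set_le c

theorem one_le_height [Nonempty P] : 1 ≤ height P := by
  obtain ⟨x⟩ := ‹Nonempty P›
  have h := mk_le_height (P := P) (c := {x}) (Set.pairwise_singleton _ _)
  rwa [Cardinal.mk_singleton] at h

theorem height_le_of_orderEmbedding (f : P ↪o Q) : height P ≤ height Q :=
  height_le fun c hc => by
    rw [← Cardinal.mk_image_eq (s := c) f.injective]
    exact mk_le_height (f.monotone.isChain_image hc)

theorem height_congr (e : P ≃o Q) : height P = height Q :=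
  le_antisymm (height_le_of_orderEmbedding e.toOrderEmbedding)
    (height_le_of_orderEmbedding e.symm.toOrderEmbedding)

theorem mk_add_mk_le_height {c d : Set P} (hc : IsChain (· ≤ ·) c) (hd : IsChain (· ≤ ·) d)
    (hcd : ∀ x ∈ c, ∀ y ∈ d, x ≤ y) : Cardinal.mk c + Cardinal.mk d ≤ height P + 1 := by
  rw [← Cardinal.mk_union_add_mk_inter]
  refine add_le_add (mk_le_height ?_) ?_
  · rintro x (hx | hx) y (hy | hy) hne
    · exact hc hx hy hne
    · exact .inl (hcd x hx y hy)
    · exact .inr (hcd y hy x hx)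
    · exact hd hx hy hne
  · rw [Cardinal.mk_le_one_iff_set_subsingleton]
    exact fun x hx y hy => le_antisymm (hcd x hx.1 y hy.2) (hcd y hy.1 x hx.2)

/-- If a copy of `Q` lies below a chain `d` of `P`, then chains of `Q` can be prolonged by `d`;
at most one element is shared. -/
theorem height_add_mk_le (f : Q ↪o P) {d : Set P} (hd : IsChain (· ≤ ·) d)
    (h : ∀ q, ∀ y ∈ d, f q ≤ y) : height Q + Cardinal.mk d ≤ height P + 1 := by
  have : Nonempty {c : Set Q // IsChain (· ≤ ·) c} := ⟨⟨∅, Set.pairwise_empty _⟩⟩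
  unfold height
  rw [Cardinal.ciSup_add _ ⟨Cardinal.mk Q, by rintro _ ⟨c, rfl⟩; exact Cardinal.mk_set_le c.1⟩]
  refine ciSup_le fun c => ?_
  rw [← Cardinal.mk_image_eq (s := c.1) f.injective]
  refine mk_add_mk_le_height (f.monotone.isChain_image c.2) hd ?_
  rintro _ ⟨q, -, rfl⟩ y hy
  exact h q y hy

theorem height_add_height_le (f : Q ↪o P) (g : R ↪o P) (h : ∀ q r, f q ≤ g r) :
    height Q + height R ≤ height P + 1 := by
  have : Nonempty {c : Set R // IsChain (· ≤ ·) c} := ⟨⟨∅, Set.pairwise_empty _⟩⟩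
  have hR : height R = ⨆ c : {c : Set R // IsChain (· ≤ ·) c}, Cardinal.mk c.1 := rfl
  rw [hR, Cardinal.add_ciSup _ ⟨Cardinal.mk R, by rintro _ ⟨c, rfl⟩; exact Cardinal.mk_set_le c.1⟩]
  refine ciSup_le fun c => ?_
  rw [← Cardinal.mk_image_eq (s := c.1) g.injective]
  refine height_add_mk_le f (g.monotone.isChain_image c.2) ?_
  rintro q _ ⟨r, -, rfl⟩
  exact h q r

open Classical in
/-- Removing the top element of a finite chain drops the number of values of `f` or of `g`. -/
theorem card_add_one_le_of_isChain {f : P → Q} {g : P → R} (hf : Monotone f) (hg : Monotone g)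
    (hfg : ∀ x y, x ≤ y → f x = f y → g x = g y → x = y) (s : Finset P)
    (hs : IsChain (· ≤ ·) (s : Set P)) (hne : s.Nonempty) :
    s.card + 1 ≤ (s.image f).card + (s.image g).card := by
  induction s using Finset.strongInduction with
  | H s ih =>
    obtain ⟨m, hm⟩ := s.exists_maximal hne
    have hmax : ∀ x ∈ s, x ≤ m := fun x hx =>
      (hs.total hx hm.1).elim id fun h => hm.2 hx h
    set t := s.erase m with ht
    have hcard : t.card + 1 = s.card := Finset.card_erase_add_one hm.1
    have hts : t ⊂ s := Finset.erase_ssubset hm.1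
    have hsub : ∀ {β : Type u} (k : P → β), (t.image k).card ≤ (s.image k).card := fun k =>
      Finset.card_le_card (Finset.image_subset_image hts.1)
    have hlt : ∀ {β : Type u} (k : P → β), k m ∉ t.image k →
        (t.image k).card + 1 ≤ (s.image k).card := fun k hk =>
      Finset.card_lt_card ((Finset.ssubset_iff_of_subset (Finset.image_subset_image hts.1)).2
        ⟨k m, Finset.mem_image_of_mem k hm.1, hk⟩)
    rcases t.eq_empty_or_nonempty with h0 | h1
    · have h1 : 0 < (s.image f).card := (hne.image f).card_pos
      have h2 : 0 < (s.image g).card := (hne.image g).card_pos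
      rw [h0, Finset.card_empty] at hcard
      omega
    · have htc : IsChain (· ≤ ·) (t : Set P) := hs.mono (Finset.coe_subset.2 hts.1)
      have := ih t hts htc h1
      obtain ⟨c, hc⟩ := t.exists_maximal h1
      have hcm : c ≠ m ∧ c ∈ s := Finset.mem_erase.1 hc.1
      have hcmax : ∀ x ∈ t, x ≤ c := fun x hx =>
        (htc.total hx hc.1).elim id fun h => hc.2 hx h
      have key : f m ∉ t.image f ∨ g m ∉ t.image g := by
        by_contra! hcon
        obtain ⟨⟨x, hx, hfx⟩, ⟨y, hy, hgy⟩⟩ :=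
          And.intro (Finset.mem_image.1 hcon.1) (Finset.mem_image.1 hcon.2)
        refine hcm.1 (hfg c m (hmax c hcm.2) ?_ ?_)
        · exact le_antisymm (hf (hmax c hcm.2)) (hfx ▸ hf (hcmax x hx))
        · exact le_antisymm (hg (hmax c hcm.2)) (hgy ▸ hg (hcmax y hy))
      have h3 := hsub f
      have h4 := hsub g
      rcases key with h | h
      · have := hlt f h
        omega
      · have := hlt g h
        omega

/-- The height of a poset that is separated by two monotone maps. Joint injectivity is only needed
on comparable pairs of elements. -/
theorem height_add_one_le [Nonempty P] {f : P → Q} {g : P → R} (hf : Monotone f) (hg : Monotone g)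
    (hfg : ∀ x y, x ≤ y → f x = f y → g x = g y → x = y) :
    height P + 1 ≤ height Q + height R := by
  classical
  have : Nonempty Q := ‹Nonempty P›.map f
  have : Nonempty R := ‹Nonempty P›.map g
  have key : ∀ c : Set P, IsChain (· ≤ ·) c → Cardinal.mk c + 1 ≤ height Q + height R := by
    intro c hc
    rcases c.eq_empty_or_nonempty with rfl | hne
    · rw [Cardinal.mk_eq_zero, zero_add]
      exact one_le_height.trans le_self_add
    have hQ := mk_le_height (hf.isChain_image hc)
    have hR := mk_le_height (hg.isChain_image hc)
    refine le_trans ?_ (add_le_add hQ hR)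
    by_cases hfin : c.Finite
    · obtain ⟨s, rfl⟩ := hfin.exists_finset_coe
      have := card_add_one_le_of_isChain hf hg hfg s hc (Finset.coe_nonempty.1 hne)
      rw [← Finset.coe_image, ← Finset.coe_image]
      simp only [SetLike.coe_sort_coe, Cardinal.mk_coe_finset]
      exact_mod_cast this
    · -- An infinite chain embeds into the product of its images, whose cardinality is at most
      -- that of the larger of the two.
      have hinf : Cardinal.aleph0 ≤ Cardinal.mk c := by
        rw [Cardinal.aleph0_le_mk_iff]
        exact Set.infinite_coe_iff.2 hfin
      have hinj : Function.Injective
          (fun x : c => ((⟨f x, x, x.2, rfl⟩, ⟨g x, x, x.2, rfl⟩) : (f '' c) × (g '' c))) := by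
        intro x y hxy
        have h1 : f x = f y := congrArg (fun z => z.1.1) hxy
        have h2 : g x = g y := congrArg (fun z => z.2.1) hxy
        rcases hc.total x.2 y.2 with h | h
        · exact Subtype.ext (hfg _ _ h h1 h2)
        · exact Subtype.ext (hfg _ _ h h1.symm h2.symm).symm
      have hle := Cardinal.mk_le_of_injective hinj
      rw [Cardinal.mk_prod, Cardinal.lift_id, Cardinal.lift_id] at hle
      rw [Cardinal.add_one_eq hinf]
      have hmax : Cardinal.aleph0 ≤ max (Cardinal.mk (f '' c)) (Cardinal.mk (g '' c)) := by
        by_contra! hlt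
        have := Cardinal.mul_lt_aleph0 (max_lt_iff.1 hlt).1 (max_lt_iff.1 hlt).2
        exact absurd (hinf.trans hle) (not_le.2 this)
      refine (hle.trans (Cardinal.mul_le_max _ _)).trans ?_
      rw [max_eq_left hmax]
      exact max_le le_self_add le_add_self
  rcases lt_or_ge (height Q + height R) Cardinal.aleph0 with hlt | hge
  · obtain ⟨k, hk⟩ := Cardinal.lt_aleph0.1 hlt
    rw [hk] at key ⊢
    obtain _ | k := k
    · have := key ∅ (Set.pairwise_empty _)
      simp at this
    · have h : height P ≤ k := height_le fun c hc => by
        have := key c hc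
        rw [Nat.cast_succ] at this
        exact Cardinal.add_one_le_add_one_iff.1 this
      rw [Nat.cast_succ]
      exact add_le_add_left h 1
  · have h : height P ≤ height Q + height R := height_le fun c hc => le_self_add.trans (key c hc)
    exact (add_le_add_left h 1).trans_eq (Cardinal.add_one_eq hge)

/-- A monotone property accounts for at most one additional element in a chain. -/
theorem height_le_add_one [Nonempty P] {f : P → Q} {p : P → Prop} (hf : Monotone f)
    (hp : Monotone p) (h : ∀ x y, x ≤ y → f x = f y → (p x ↔ p y) → x = y) :
    height P ≤ height Q + 1 := by
  have h1 := height_add_one_le (g := fun x => ULift.up.{u} (p x)) hf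
    (fun x y hxy => hp hxy) fun x y hxy h1 h2 => h x y hxy h1 (by simpa using h2)
  have h2 : height (ULift.{u} Prop) ≤ 2 := height_le_mk.trans (by simp)
  have h3 : height P + 1 ≤ (height Q + 1) + 1 := by
    rw [add_assoc, one_add_one_eq_two]
    exact h1.trans (by gcongr)
  exact Cardinal.add_one_le_add_one_iff.1 h3

end Height

/-! ### Congruences of unary algebras -/

section Unary

variable {ι : Type v}

theorem sup_mem_unaryCong {A : Type u} {op : ι → A → A} {σ τ : Setoid A}
    (hσ : σ ∈ unaryCong op) (hτ : τ ∈ unaryCong op) : σ ⊔ τ ∈ unaryCong op := by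
  intro i
  have h : σ ⊔ τ ≤ (σ ⊔ τ).comap (op i) :=
    sup_le (fun a b h => le_sup_left (a := σ) (hσ i a b h))
      fun a b h => le_sup_right (b := τ) (hτ i a b h)
  exact fun a b hab => h hab

theorem top_mem_unaryCong {A : Type u} (op : ι → A → A) : ⊤ ∈ unaryCong op :=
  fun _ _ _ _ => trivial

instance {A : Type u} (op : ι → A → A) : Nonempty (unaryCong op) := ⟨⟨⊤, top_mem_unaryCong op⟩⟩

theorem IsUniqueMaximalCong.maximal {A : Type u} {op : ι → A → A} {τ : Setoid A}
    (h : IsUniqueMaximalCong op τ) : Maximal (fun ρ : Setoid A => ρ ∈ unaryCong op ∧ ρ ≠ ⊤) τ :=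
  (h τ).2 rfl

variable {X A B : Type u}

/-- The image of `σ` under a surjection `φ : A → B` that collapses the range of `i` to a point:
two points of `B` are related if they are images of `σ`-related points, or of points that are
`σ`-related to the range of `i`. -/
def collapse (i : X → A) (φ : A → B) (hφ : Function.Surjective φ)
    (hker : ∀ a b, φ a = φ b ↔ a = b ∨ (a ∈ Set.range i ∧ b ∈ Set.range i)) (σ : Setoid A) :
    Setoid B where
  r u v := ∃ a b, φ a = u ∧ φ b = v ∧ (σ a b ∨ ((∃ x, σ a (i x)) ∧ ∃ y, σ b (i y)))
  iseqv :=
    { refl := fun u => by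
        obtain ⟨a, rfl⟩ := hφ u
        exact ⟨a, a, rfl, rfl, .inl (σ.refl' a)⟩
      symm := by
        rintro u v ⟨a, b, ha, hb, h | h⟩
        · exact ⟨b, a, hb, ha, .inl (σ.symm' h)⟩
        · exact ⟨b, a, hb, ha, .inr ⟨h.2, h.1⟩⟩
      trans := by
        rintro u v w ⟨a, b, ha, hb, h⟩ ⟨b', c, hb', hc, k⟩
        refine ⟨a, c, ha, hc, ?_⟩
        rcases (hker b b').1 (hb.trans hb'.symm) with rfl | ⟨⟨x, rfl⟩, ⟨y, rfl⟩⟩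
        · rcases h with h | h
          · rcases k with k | k
            · exact .inl (σ.trans' h k)
            · obtain ⟨⟨x, hx⟩, k⟩ := k
              exact .inr ⟨⟨x, σ.trans' h hx⟩, k⟩
          · obtain ⟨h, ⟨x, hx⟩⟩ := h
            rcases k with k | k
            · exact .inr ⟨h, ⟨x, σ.trans' (σ.symm' k) hx⟩⟩
            · exact .inr ⟨h, k.2⟩
        · refine .inr ⟨?_, ?_⟩
          · exact h.elim (fun h => ⟨x, h⟩) fun h => h.1
          · exact k.elim (fun k => ⟨y, σ.symm' k⟩) fun k => k.2 }

/-- The extension of `σ` along an injection, by equality outside the range. -/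
def extendId (i : X → A) (hi : Function.Injective i) (σ : Setoid X) : Setoid A where
  r a b := a = b ∨ ∃ x y, i x = a ∧ i y = b ∧ σ x y
  iseqv :=
    { refl := fun a => .inl rfl
      symm := by
        rintro a b (rfl | ⟨x, y, hx, hy, h⟩)
        · exact .inl rfl
        · exact .inr ⟨y, x, hy, hx, σ.symm' h⟩
      trans := by
        rintro a b c (rfl | ⟨x, y, hx, rfl, h⟩) k
        · exact k
        · rcases k with rfl | ⟨x', z, hx', hz, k⟩
          · exact .inr ⟨x, y, hx, rfl, h⟩
          · obtain rfl := hi hx'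
            exact .inr ⟨x, z, hx, hz, σ.trans' h k⟩ }

/-- If the unary algebra `B` is the quotient of `A` by a subalgebra `X` collapsed to a point, then
a congruence of `A` is determined, among the congruences comparable to it, by its trace on `X` and
its image in `B`. Conversely the congruences of `X` and of `B` lift to two consecutive intervals of
congruences of `A`. -/
theorem height_unaryCong_extension [Nonempty X] {opX : ι → X → X} {op : ι → A → A}
    {opB : ι → B → B}
    (i : X → A) (hi : Function.Injective i) (hi_op : ∀ s x, i (opX s x) = op s (i x))
    (φ : A → B) (hφ : Function.Surjective φ) (hφ_op : ∀ s a, φ (op s a) = opB s (φ a))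
    (hker : ∀ a b, φ a = φ b ↔ a = b ∨ (a ∈ Set.range i ∧ b ∈ Set.range i)) :
    height (unaryCong op) + 1 = height (unaryCong opX) + height (unaryCong opB) := by
  refine le_antisymm ?_ ?_
  · refine height_add_one_le
      (f := fun σ => ⟨σ.1.comap i, fun s a b h => ?_⟩)
      (g := fun σ => ⟨collapse i φ hφ hker σ.1, ?_⟩) ?_ ?_ ?_
    · change σ.1 _ _
      rw [hi_op, hi_op]
      exact σ.2 s _ _ h
    · rintro s _ _ ⟨a, b, rfl, rfl, h⟩
      refine ⟨op s a, op s b, hφ_op s a, hφ_op s b, h.imp (σ.2 s a b) ?_⟩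
      rintro ⟨⟨x, hx⟩, ⟨y, hy⟩⟩
      refine ⟨⟨opX s x, ?_⟩, ⟨opX s y, ?_⟩⟩ <;> rw [hi_op] <;> exact σ.2 s _ _ ‹_›
    · exact fun σ τ h a b hab => h hab
    · rintro σ τ h u v ⟨a, b, ha, hb, hab⟩
      exact ⟨a, b, ha, hb, hab.imp (fun k => h k)
        fun k => ⟨k.1.imp fun x hx => h hx, k.2.imp fun x hx => h hx⟩⟩
    · intro σ τ hle h1 h2
      have htrace : ∀ x y, τ.1 (i x) (i y) → σ.1 (i x) (i y) := fun x y h => by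
        have h1 : σ.1.comap i = τ.1.comap i := congrArg Subtype.val h1
        have : τ.1.comap i x y := h
        rwa [← h1] at this
      have himg : ∀ a b, τ.1 a b → σ.1 a b ∨ ((∃ x, σ.1 a (i x)) ∧ ∃ y, σ.1 b (i y)) := by
        intro a b h
        have h2 : collapse i φ hφ hker σ.1 = collapse i φ hφ hker τ.1 := congrArg Subtype.val h2
        have : collapse i φ hφ hker τ.1 (φ a) (φ b) := ⟨a, b, rfl, rfl, .inl h⟩
        rw [← h2] at this
        obtain ⟨a', b', ha, hb, k⟩ := this
        have refl : ∀ x, σ.1 (i x) (i x) := fun x => σ.1.refl' _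
        rcases (hker a' a).1 ha with rfl | ⟨⟨x, rfl⟩, ⟨y, rfl⟩⟩
        · rcases (hker b' b).1 hb with rfl | ⟨⟨x, rfl⟩, ⟨y, rfl⟩⟩
          · exact k
          · exact .inr ⟨k.elim (fun h => ⟨x, h⟩) fun h => h.1, ⟨y, refl y⟩⟩
        · rcases (hker b' b).1 hb with rfl | ⟨⟨z, rfl⟩, ⟨w, rfl⟩⟩
          · exact .inr ⟨⟨y, refl y⟩, k.elim (fun h => ⟨x, σ.1.symm' h⟩) fun h => h.2⟩
          · exact .inr ⟨⟨y, refl y⟩, ⟨w, refl w⟩⟩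
      refine le_antisymm hle fun a b h => ?_
      rcases himg a b h with h' | ⟨⟨x, hx⟩, ⟨y, hy⟩⟩
      · exact h'
      · refine σ.1.trans' hx (σ.1.trans' (htrace x y ?_) (σ.1.symm' hy))
        exact τ.1.trans' (τ.1.symm' (hle hx)) (τ.1.trans' h (hle hy))
  · let f : unaryCong opX ↪o unaryCong op := OrderEmbedding.ofMapLEIff
      (fun σ => ⟨extendId i hi σ.1, by
        rintro s a b (rfl | ⟨x, y, rfl, rfl, h⟩)
        · exact .inl rfl
        · exact .inr ⟨opX s x, opX s y, hi_op s x, hi_op s y, σ.2 s x y h⟩⟩)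
      (by
        refine fun σ τ => ⟨fun h x y hxy => ?_, ?_⟩
        · rcases h (x := i x) (y := i y) (.inr ⟨x, y, rfl, rfl, hxy⟩) with h | ⟨x', y', hx, hy, h⟩
          · rw [hi h]
          · rwa [hi hx, hi hy] at h
        · rintro h a b (rfl | ⟨x, y, hx, hy, k⟩)
          · exact .inl rfl
          · exact .inr ⟨x, y, hx, hy, h k⟩)
    let g : unaryCong opB ↪o unaryCong op := OrderEmbedding.ofMapLEIff
      (fun σ => ⟨σ.1.comap φ, fun s a b h => by
        change σ.1 _ _
        rw [hφ_op, hφ_op]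
        exact σ.2 s _ _ h⟩)
      (by
        refine fun σ τ => ⟨fun h u v huv => ?_, fun h a b hab => h hab⟩
        obtain ⟨a, rfl⟩ := hφ u
        obtain ⟨b, rfl⟩ := hφ v
        exact h (x := a) (y := b) huv)
    refine height_add_height_le f g ?_
    rintro σ τ a b (rfl | ⟨x, y, rfl, rfl, h⟩)
    · exact τ.1.refl' _
    · change τ.1 _ _
      rw [(hker (i x) (i y)).2 (.inr ⟨⟨x, rfl⟩, ⟨y, rfl⟩⟩)]

end Unary

/-! ### Green's relations in a stable semigroup -/

section RelOn

variable {α : Type u} {J : Set α} {σ : Setoid J} {a b c : α}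

/-- Two elements of the ambient type lie in `J` and are related by the equivalence `σ` on `J`. -/
def RelOn (σ : Setoid J) (a b : α) : Prop :=
  ∃ (ha : a ∈ J) (hb : b ∈ J), σ ⟨a, ha⟩ ⟨b, hb⟩

theorem relOn_coe {a b : J} : RelOn σ a b ↔ σ a b := ⟨fun ⟨_, _, h⟩ => h, fun h => ⟨_, _, h⟩⟩

theorem RelOn.refl (σ : Setoid J) (ha : a ∈ J) : RelOn σ a a := ⟨ha, ha, σ.refl' _⟩

theorem RelOn.symm (h : RelOn σ a b) : RelOn σ b a :=
  let ⟨ha, hb, h⟩ := h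
  ⟨hb, ha, σ.symm' h⟩

theorem RelOn.trans (h : RelOn σ a b) (k : RelOn σ b c) : RelOn σ a c :=
  let ⟨ha, _, h⟩ := h
  let ⟨_, hc, k⟩ := k
  ⟨ha, hc, σ.trans' h k⟩

end RelOn

section Green

variable {S : Type u} [Semigroup S]

/-- The left action of `S¹` on `S`, with `S¹` encoded as `WithOne S`. -/
def lmul (s : WithOne S) (x : S) : S := WithOne.recOneCoe x (fun s => s * x) s

/-- The right action of `S¹` on `S`, with `S¹` encoded as `WithOne S`. -/
def rmul (x : S) (t : WithOne S) : S := WithOne.recOneCoe x (fun t => x * t) t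

@[simp]
theorem coe_lmul (s : WithOne S) (x : S) : ((lmul s x : S) : WithOne S) = s * x := by
  induction s using WithOne.recOneCoe with
  | one => simp [lmul]
  | coe s => simp [lmul]

@[simp]
theorem coe_rmul (x : S) (t : WithOne S) : ((rmul x t : S) : WithOne S) = x * t := by
  induction t using WithOne.recOneCoe with
  | one => simp [rmul]
  | coe s => simp [rmul]

theorem lmul_rmul (s t : WithOne S) (x : S) : lmul s (rmul x t) = rmul (lmul s x) t :=
  WithOne.coe_injective (by simp [mul_assoc])

theorem leL_iff {x y : S} : LeL x y ↔ ∃ s, lmul s y = x :=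
  exists_congr fun s => by rw [← coe_lmul, WithOne.coe_inj, eq_comm]

theorem leR_iff {x y : S} : LeR x y ↔ ∃ t, rmul y t = x :=
  exists_congr fun s => by rw [← coe_rmul, WithOne.coe_inj, eq_comm]

theorem leL_lmul (s : WithOne S) (x : S) : LeL (lmul s x) x := leL_iff.2 ⟨s, rfl⟩

theorem leR_rmul (x : S) (t : WithOne S) : LeR (rmul x t) x := leR_iff.2 ⟨t, rfl⟩

theorem LeL.leJ {x y : S} (h : LeL x y) : LeJ x y := h.imp fun s hs => ⟨1, by simpa using hs⟩

theorem LeR.leJ {x y : S} (h : LeR x y) : LeJ x y := by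
  obtain ⟨t, ht⟩ := h
  exact ⟨1, t, by simpa using ht⟩

theorem LeJ.exists {x y : S} (h : LeJ x y) : ∃ s t, lmul s (rmul y t) = x := by
  obtain ⟨s, t, h⟩ := h
  exact ⟨s, t, WithOne.coe_injective (by simp [h, mul_assoc])⟩

theorem LeL.rmul {x y : S} (h : LeL x y) (t : WithOne S) : LeL (rmul x t) (rmul y t) := by
  obtain ⟨s, rfl⟩ := leL_iff.1 h
  exact leL_iff.2 ⟨s, lmul_rmul s t y⟩

theorem LeR.lmul {x y : S} (h : LeR x y) (s : WithOne S) : LeR (lmul s x) (lmul s y) := by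
  obtain ⟨t, rfl⟩ := leR_iff.1 h
  exact leR_iff.2 ⟨t, (lmul_rmul s t y).symm⟩

theorem greenL_rmul {x y : S} (h : greenL S x y) (t : WithOne S) :
    greenL S (rmul x t) (rmul y t) :=
  ⟨h.1.rmul t, h.2.rmul t⟩

theorem greenR_lmul {x y : S} (h : greenR S x y) (s : WithOne S) :
    greenR S (lmul s x) (lmul s y) :=
  ⟨h.1.lmul s, h.2.lmul s⟩

theorem greenL_le_greenJ : greenL S ≤ greenJ S := fun _ _ h => ⟨h.1.leJ, h.2.leJ⟩

theorem IsStable.greenL_lmul (hS : IsStable S) {x : S} {s : WithOne S}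
    (h : LeJ x (lmul s x)) : greenL S x (lmul s x) := by
  induction s using WithOne.recOneCoe with
  | one => exact (greenL S).refl' x
  | coe s =>
    exact (hS _ (Setoid.mem_classes _ x) x ((greenJ S).refl' x) s).1
      ⟨h, (leL_lmul (s : WithOne S) x).leJ⟩

theorem IsStable.greenR_rmul (hS : IsStable S) {x : S} {t : WithOne S}
    (h : LeJ x (rmul x t)) : greenR S x (rmul x t) := by
  induction t using WithOne.recOneCoe with
  | one => exact (greenR S).refl' x
  | coe t =>
    exact (hS _ (Setoid.mem_classes _ x) x ((greenJ S).refl' x) t).2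
      ⟨h, (leR_rmul x (t : WithOne S)).leJ⟩

theorem leJ_of_lmul_rmul {x : S} {s t : WithOne S} (h : LeJ x (lmul s (rmul x t))) :
    LeJ x (lmul s x) ∧ LeJ x (rmul x t) :=
  ⟨h.trans (by rw [lmul_rmul]; exact (leR_rmul _ _).leJ), h.trans (leL_lmul _ _).leJ⟩

/-- Within a stable `J`-class, left translations respect `H`, and whether such a translation leaves
the `J`-class depends only on the `H`-class. -/
theorem IsStable.greenH_lmul (hS : IsStable S) {a b : S} (hab : greenH S a b) {s : WithOne S}
    (h : LeJ a (lmul s a)) : LeJ b (lmul s b) ∧ greenH S (lmul s a) (lmul s b) := by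
  have hR := greenR_lmul hab.2 s
  have hJ : LeJ b (lmul s b) := hab.1.2.leJ.trans (h.trans hR.1.leJ)
  exact ⟨hJ, (greenL S).trans' ((greenL S).symm' (hS.greenL_lmul h))
    ((greenL S).trans' hab.1 (hS.greenL_lmul hJ)), hR⟩

/-- Within a stable `J`-class, right translations respect `H`, and whether such a translation leaves
the `J`-class depends only on the `H`-class. -/
theorem IsStable.greenH_rmul (hS : IsStable S) {a b : S} (hab : greenH S a b) {t : WithOne S}
    (h : LeJ a (rmul a t)) : LeJ b (rmul b t) ∧ greenH S (rmul a t) (rmul b t) := by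
  have hL := greenL_rmul hab.1 t
  have hJ : LeJ b (rmul b t) := hab.1.2.leJ.trans (h.trans hL.1.leJ)
  exact ⟨hJ, hL, (greenR S).trans' ((greenR S).symm' (hS.greenR_rmul h))
    ((greenR S).trans' hab.2 (hS.greenR_rmul hJ))⟩

/-- Two-sided translations within a `J`-class can be undone, simultaneously on an `H`-class. -/
theorem IsStable.exists_inverse (hS : IsStable S) {a : S} {s t : WithOne S}
    (h : LeJ a (lmul s (rmul a t))) :
    ∃ s' t', ∀ b, greenH S a b → lmul s' (rmul (lmul s (rmul b t)) t') = b := by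
  obtain ⟨s', hs'⟩ := leL_iff.1 (hS.greenL_lmul (leJ_of_lmul_rmul h).1).1
  obtain ⟨t', ht'⟩ := leR_iff.1 (hS.greenR_rmul (leJ_of_lmul_rmul h).2).1
  refine ⟨s', t', fun b hab => ?_⟩
  have h1 : rmul (rmul b t) t' = b := by
    obtain ⟨w, rfl⟩ := leL_iff.1 hab.1.2
    rw [← lmul_rmul, ← lmul_rmul, ht']
  obtain ⟨w, rfl⟩ := leR_iff.1 hab.2.2
  rw [← lmul_rmul, h1, lmul_rmul, lmul_rmul, hs']

/-! ### The Schützenberger group -/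

variable {H : Set S} (hH : H ∈ (greenH S).classes)

include hH in
theorem rmul_mem_of_rmul_mem {x y : S} {t : WithOne S} (hx : x ∈ H) (hy : y ∈ H)
    (hxt : rmul x t ∈ H) : rmul y t ∈ H := by
  have hxy := rel_of_mem_class hH hx hy
  have hxxt := rel_of_mem_class hH hx hxt
  obtain ⟨t', ht'⟩ := leR_iff.1 hxxt.2.1
  obtain ⟨u, hu⟩ := leL_iff.1 hxy.1.2
  refine mem_class_of_rel hH hy ⟨?_, ?_, leR_rmul y t⟩
  · exact (greenL S).trans' ((greenL S).symm' hxy.1)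
      ((greenL S).trans' hxxt.1 (greenL_rmul hxy.1 t))
  · exact leR_iff.2 ⟨t', by rw [← hu, ← lmul_rmul, ← lmul_rmul, ht']⟩

theorem exists_schutzenberger_of_rmul_mem {x : S} {t : WithOne S} (hx : x ∈ H)
    (hxt : rmul x t ∈ H) : ∃ f ∈ schutzenbergerGroup H hH, ∀ y : H, (f y : S) = rmul (y : S) t := by
  obtain ⟨t', ht'⟩ := leR_iff.1 (rel_of_mem_class hH hx hxt).2.1
  have hxt' : rmul (rmul x t) t' ∈ H := ht'.symm ▸ hx
  refine ⟨⟨fun y => ⟨rmul y t, rmul_mem_of_rmul_mem hH hx y.2 hxt⟩,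
    fun y => ⟨rmul y t', rmul_mem_of_rmul_mem hH hxt y.2 hxt'⟩, fun y => Subtype.ext ?_,
    fun y => Subtype.ext ?_⟩, ⟨t, fun y => coe_rmul _ _⟩, fun y => rfl⟩
  · obtain ⟨u, hu⟩ := leL_iff.1 (rel_of_mem_class hH y.2 hx).1.1
    change rmul (rmul _ t) t' = _
    rw [← hu, ← lmul_rmul, ← lmul_rmul, ht']
  · obtain ⟨u, hu⟩ := leL_iff.1 (rel_of_mem_class hH y.2 hxt).1.1
    change rmul (rmul _ t') t = _
    rw [← hu, ← lmul_rmul, ← lmul_rmul, ht']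

theorem exists_schutzenberger_apply_eq (x y : H) : ∃ f ∈ schutzenbergerGroup H hH, f x = y := by
  obtain ⟨t, ht⟩ := leR_iff.1 (rel_of_mem_class hH x.2 y.2).2.2
  obtain ⟨f, hf, h⟩ := exists_schutzenberger_of_rmul_mem hH x.2 (ht.symm ▸ y.2 : rmul _ t ∈ H)
  exact ⟨f, hf, Subtype.ext ((h x).trans ht)⟩

theorem exists_rmul_of_mem_schutzenberger {f : Equiv.Perm H}
    (hf : f ∈ schutzenbergerGroup H hH) : ∃ t, ∀ x : H, (f x : S) = rmul (x : S) t := by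
  obtain ⟨t, ht⟩ := hf
  exact ⟨t, fun x => WithOne.coe_injective (by rw [ht, coe_rmul])⟩

/-- The elements of the Schützenberger group commute with left translations. -/
theorem schutzenberger_lmul {f : Equiv.Perm H} (hf : f ∈ schutzenbergerGroup H hH) {x y : H}
    {u : WithOne S}
    (h : lmul u (x : S) = y) : (f y : S) = lmul u (f x : S) := by
  obtain ⟨t, ht⟩ := exists_rmul_of_mem_schutzenberger hH hf
  rw [ht, ht, ← h, lmul_rmul]

theorem schutzenberger_ext {f g : Equiv.Perm H} (hf : f ∈ schutzenbergerGroup H hH)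
    (hg : g ∈ schutzenbergerGroup H hH) {x : H} (h : f x = g x) : f = g := by
  refine Equiv.ext fun y => Subtype.ext ?_
  obtain ⟨u, hu⟩ := leL_iff.1 (rel_of_mem_class hH y.2 x.2).1.1
  rw [schutzenberger_lmul hH hf hu, schutzenberger_lmul hH hg hu, h]

/-! ### Congruences below `H` and normal subgroups -/

/-- The congruences of (the principal factor of) a `J`-class `J` that are contained in Green's
relation `H`, as equivalence relations on `J`. Compatibility is required only for those products
that stay in `J`. -/
def congBelowH (J : Set S) : Set (Setoid J) :=
  {σ | σ ≤ restrictH J ∧ ∀ (i : S ⊕ S) (a b : J), σ a b →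
    ∀ (ha : biactOp S i a ∈ J) (hb : biactOp S i b ∈ J), σ ⟨_, ha⟩ ⟨_, hb⟩}

section RelOn

variable {J : Set S} {σ : Setoid J} {a b : S}

theorem RelOn.greenH (hσ : σ ∈ congBelowH J) (h : RelOn σ a b) : greenH S a b :=
  let ⟨_, _, h⟩ := h
  hσ.1 h

theorem RelOn.lmul (hS : IsStable S) (hJ : J ∈ (greenJ S).classes) (hσ : σ ∈ congBelowH J)
    (h : RelOn σ a b) {s : WithOne S} (ha : lmul s a ∈ J) : RelOn σ (lmul s a) (lmul s b) := by
  have hk := hS.greenH_lmul (h.greenH hσ) (rel_of_mem_class hJ h.1 ha).1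
  have hb := mem_class_of_rel hJ ha (greenL_le_greenJ hk.2.1)
  obtain ⟨ha', hb', h⟩ := h
  induction s using WithOne.recOneCoe with
  | one => exact ⟨ha', hb', h⟩
  | coe s => exact ⟨ha, hb, hσ.2 (.inl s) _ _ h ha hb⟩

theorem RelOn.rmul (hS : IsStable S) (hJ : J ∈ (greenJ S).classes) (hσ : σ ∈ congBelowH J)
    (h : RelOn σ a b) {t : WithOne S} (ha : rmul a t ∈ J) : RelOn σ (rmul a t) (rmul b t) := by
  have hk := hS.greenH_rmul (h.greenH hσ) (rel_of_mem_class hJ h.1 ha).1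
  have hb := mem_class_of_rel hJ ha (greenL_le_greenJ hk.2.1)
  obtain ⟨ha', hb', h⟩ := h
  induction t using WithOne.recOneCoe with
  | one => exact ⟨ha', hb', h⟩
  | coe t => exact ⟨ha, hb, hσ.2 (.inr t) _ _ h ha hb⟩

theorem RelOn.lmul_rmul (hS : IsStable S) (hJ : J ∈ (greenJ S).classes) (hσ : σ ∈ congBelowH J)
    (h : RelOn σ a b) {s t : WithOne S} (ha : GreenHeight.lmul s (GreenHeight.rmul a t) ∈ J) :
    RelOn σ (GreenHeight.lmul s (GreenHeight.rmul a t))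
      (GreenHeight.lmul s (GreenHeight.rmul b t)) := by
  have h1 : GreenHeight.rmul a t ∈ J := mem_class_of_rel hJ h.1
    ⟨(leJ_of_lmul_rmul (rel_of_mem_class hJ h.1 ha).1).2, (leR_rmul _ _).leJ⟩
  exact (h.rmul hS hJ hσ h1).lmul hS hJ hσ ha

end RelOn

variable {J : Set S}

theorem IsStable.greenH_lmul_rmul (hS : IsStable S) {a b : S} (hab : greenH S a b)
    {s t : WithOne S} (h : LeJ a (lmul s (rmul a t))) :
    greenH S (lmul s (rmul a t)) (lmul s (rmul b t)) :=
  (hS.greenH_lmul (hS.greenH_rmul hab (leJ_of_lmul_rmul h).2).2 ((leR_rmul _ _).leJ.trans h)).2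

/-- Every point of `J` can be moved into a given `H`-class of `J` by a two-sided translation. -/
theorem exists_lmul_rmul_mem (hJ : J ∈ (greenJ S).classes) (hHJ : H ⊆ J) {h : S} (hh : h ∈ H)
    {a : S} (ha : a ∈ J) : ∃ s t, lmul s (rmul a t) ∈ H := by
  obtain ⟨s, t, hst⟩ := (rel_of_mem_class hJ (hHJ hh) ha).1.exists
  exact ⟨s, t, hst.symm ▸ hh⟩

theorem exists_mem_of_mem_classes {α : Type u} {σ : Setoid α} {X : Set α} (hX : X ∈ σ.classes) :
    ∃ x, x ∈ X := by
  obtain ⟨x, rfl⟩ := hX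
  exact ⟨x, σ.refl' x⟩

theorem relOn_apply_of_relOn_apply (hS : IsStable S) (hJ : J ∈ (greenJ S).classes) (hHJ : H ⊆ J)
    {σ : Setoid J} (hσ : σ ∈ congBelowH J) {f : Equiv.Perm H}
    (hf : f ∈ schutzenbergerGroup H hH) {x : H} (h : RelOn σ (x : S) (f x : S)) (y : H) :
    RelOn σ (y : S) (f y : S) := by
  obtain ⟨u, hu⟩ := leL_iff.1 (rel_of_mem_class hH y.2 x.2).1.1
  rw [schutzenberger_lmul hH hf hu, ← hu]
  exact h.lmul hS hJ hσ (hu.symm ▸ hHJ y.2)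

/-- The normal subgroup of the Schützenberger group of `H` consisting of those permutations that
move each point within its class of the congruence `σ`. -/
def subgroupOfCong (hS : IsStable S) (hJ : J ∈ (greenJ S).classes) (hHJ : H ⊆ J)
    (σ : congBelowH J) : NSub (schutzenbergerGroup H hH) :=
  ⟨{ carrier := {f | ∀ x : H, RelOn σ.1 (x : S) (f.1 x : S)}
     one_mem' := fun x => .refl _ (hHJ x.2)
     mul_mem' := fun {f g} hf hg x => (hg x).trans (hf (g.1 x))
     inv_mem' := fun {f} hf x => by
       have h := hf (f.1⁻¹ x)
       rw [show f.1 (f.1⁻¹ x) = x from f.1.apply_symm_apply x] at h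
       exact h.symm },
    ⟨fun f hf g x => by
      obtain ⟨t, ht⟩ := exists_rmul_of_mem_schutzenberger hH g.2
      have h := hf (g.1⁻¹ x)
      have hx : g.1 (g.1⁻¹ x) = x := g.1.apply_symm_apply x
      have h1 := ht (g.1⁻¹ x)
      rw [hx] at h1
      have h2 := h.rmul hS hJ σ.2 (t := t) (h1 ▸ hHJ x.2)
      rw [← h1, ← ht] at h2
      exact h2⟩⟩

/-- The congruence below `H` determined by a normal subgroup `N` of the Schützenberger group:
`a` and `b` are related if every two-sided translation that moves them into the chosen `H`-class
moves them into the same orbit of `N`. -/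
def congOfSubgroup (N : NSub (schutzenbergerGroup H hH)) (J : Set S) : Setoid J where
  r a b := greenH S a b ∧ (∀ s t, lmul s (rmul (a : S) t) ∈ H ↔ lmul s (rmul (b : S) t) ∈ H) ∧
    ∀ s t (ha : lmul s (rmul (a : S) t) ∈ H),
      ∃ f ∈ N.1, lmul s (rmul (b : S) t) = (f.1 ⟨_, ha⟩ : S)
  iseqv :=
    { refl := fun a => ⟨(greenH S).refl' _, fun _ _ => Iff.rfl, fun s t h => ⟨1, N.1.one_mem, rfl⟩⟩
      symm := by
        rintro a b ⟨h, h', k⟩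
        refine ⟨(greenH S).symm' h, fun s t => (h' s t).symm, fun s t hb => ?_⟩
        obtain ⟨f, hf, hfb⟩ := k s t ((h' s t).2 hb)
        refine ⟨f⁻¹, N.1.inv_mem hf, ?_⟩
        have : (⟨_, hb⟩ : H) = f.1 ⟨_, (h' s t).2 hb⟩ := Subtype.ext hfb
        rw [this]
        exact congrArg Subtype.val (f.1.symm_apply_apply ⟨_, (h' s t).2 hb⟩).symm
      trans := by
        rintro a b c ⟨h, h', k⟩ ⟨l, l', m⟩
        refine ⟨(greenH S).trans' h l, fun s t => (h' s t).trans (l' s t), fun s t ha => ?_⟩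
        obtain ⟨f, hf, hfb⟩ := k s t ha
        obtain ⟨g, hg, hgc⟩ := m s t ((h' s t).1 ha)
        refine ⟨g * f, N.1.mul_mem hg hf, ?_⟩
        rw [hgc]
        exact congrArg (fun z => (g.1 z : S)) (Subtype.ext hfb) }

theorem congOfSubgroup_mem (hS : IsStable S) (hJ : J ∈ (greenJ S).classes)
    (N : NSub (schutzenbergerGroup H hH)) : congOfSubgroup hH N J ∈ congBelowH J := by
  refine ⟨fun a b h => h.1, ?_⟩
  rintro (s | t) a b ⟨h, h', k⟩ ha hb
  · have e : ∀ (x : S) u v, lmul u (rmul (biactOp S (.inl s) x) v) =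
        lmul (u * (s : WithOne S)) (rmul x v) := by
      intro x u v
      exact WithOne.coe_injective (by simp [biactOp, leftOp, mul_assoc])
    have h1 := hS.greenH_lmul (s := (s : WithOne S)) h (rel_of_mem_class hJ a.2 ha).1
    refine ⟨h1.2, fun u v => ?_, fun u v => ?_⟩
    · simp only [e]
      exact h' _ _
    · simp only [e]
      exact k _ _
  · have e : ∀ (x : S) u v, lmul u (rmul (biactOp S (.inr t) x) v) =
        lmul u (rmul x ((t : WithOne S) * v)) := by
      intro x u v
      exact WithOne.coe_injective (by simp [biactOp, rightOp, mul_assoc])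
    have h1 := hS.greenH_rmul (t := (t : WithOne S)) h (rel_of_mem_class hJ a.2 ha).1
    refine ⟨h1.2, fun u v => ?_, fun u v => ?_⟩
    · simp only [e]
      exact h' _ _
    · simp only [e]
      exact k _ _

/-- A two-sided translation that maps some point of `H` into `H` is, on `H`, a left translation
of `H` followed by a member of the Schützenberger group. -/
theorem exists_schutzenberger_lmul_rmul (hS : IsStable S) {x : S} {s t : WithOne S} (hx : x ∈ H)
    (h : lmul s (rmul x t) ∈ H) :
    lmul s x ∈ H ∧ ∃ g ∈ schutzenbergerGroup H hH, ∀ y : H, (hy : lmul s (y : S) ∈ H) →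
      lmul s (rmul (y : S) t) = g ⟨_, hy⟩ := by
  have hxs := rel_of_mem_class hH hx h
  have hJ := leJ_of_lmul_rmul hxs.1.1.leJ
  have hsx : lmul s x ∈ H := by
    refine mem_class_of_rel hH hx ⟨hS.greenL_lmul hJ.1, ?_⟩
    exact (greenR S).trans' hxs.2 ((greenR S).symm' (greenR_lmul (hS.greenR_rmul hJ.2) s))
  rw [lmul_rmul] at h
  obtain ⟨g, hg, hgt⟩ := exists_schutzenberger_of_rmul_mem hH hsx h
  exact ⟨hsx, g, hg, fun y hy => by rw [lmul_rmul, hgt]⟩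

/-- Congruences of a stable `J`-class contained in Green's relation `H` correspond to normal
subgroups of the Schützenberger group of any of its `H`-classes. -/
noncomputable def congBelowHOrderIso (hS : IsStable S) (hJ : J ∈ (greenJ S).classes)
    (hHJ : H ⊆ J) : congBelowH J ≃o NSub (schutzenbergerGroup H hH) :=
  RelIso.ofSurjective
    (OrderEmbedding.ofMapLEIff (subgroupOfCong hH hS hJ hHJ) (by
      refine fun σ τ => ⟨fun hle => ?_, fun hle f hf x =>
        let ⟨ha, hb, h⟩ := hf x
        ⟨ha, hb, hle h⟩⟩
      intro a b hab
      -- Move a `σ`-related pair into the chosen `H`-class, where it is related by an element of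
      -- the subgroup, and move it back.
      obtain ⟨h, hh⟩ := exists_mem_of_mem_classes hH
      obtain ⟨s, t, hst⟩ := exists_lmul_rmul_mem hJ hHJ hh a.2
      have hab' := σ.2.1 hab
      have haJ := (rel_of_mem_class hJ a.2 (hHJ hst)).1
      have hst' : lmul s (rmul (b : S) t) ∈ H :=
        mem_class_of_rel hH hst (hS.greenH_lmul_rmul hab' haJ)
      obtain ⟨f, hf, hfab⟩ := exists_schutzenberger_apply_eq hH ⟨_, hst⟩ ⟨_, hst'⟩
      have h1 := (relOn_coe.2 hab).lmul_rmul hS hJ σ.2 (hHJ hst)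
      have h2 : (⟨f, hf⟩ : schutzenbergerGroup H hH) ∈ (subgroupOfCong hH hS hJ hHJ σ).1 := by
        refine relOn_apply_of_relOn_apply hH hS hJ hHJ σ.2 hf (x := ⟨_, hst⟩) ?_
        rwa [hfab]
      have h3 := hle h2 ⟨_, hst⟩
      simp only [hfab] at h3
      obtain ⟨s', t', hinv⟩ := hS.exists_inverse haJ
      have ha := hinv a ((greenH S).refl' _)
      have h4 := h3.lmul_rmul hS hJ τ.2 (s := s') (t := t') (ha.symm ▸ a.2)
      rw [ha, hinv b hab'] at h4
      exact relOn_coe.1 h4))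
    (by
      intro N
      refine ⟨⟨congOfSubgroup hH N J, congOfSubgroup_mem hH hS hJ N⟩, ?_⟩
      refine Subtype.ext (Subgroup.ext fun f => ⟨fun hf => ?_, fun hf x => ?_⟩)
      · obtain ⟨h, hh⟩ := exists_mem_of_mem_classes hH
        obtain ⟨_, _, _, _, k⟩ := hf ⟨h, hh⟩
        obtain ⟨g, hg, hgf⟩ := k 1 1 hh
        have : f = g := Subtype.ext (schutzenberger_ext hH f.2 g.2 (x := ⟨h, hh⟩)
          (Subtype.ext hgf))
        exact this ▸ hg
      · have hxf : greenH S x (f.1 x) := rel_of_mem_class hH x.2 (f.1 x).2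
        have hiff : ∀ s t, lmul s (rmul (x : S) t) ∈ H ↔ lmul s (rmul (f.1 x : S) t) ∈ H := by
          refine fun s t => ⟨fun h => ?_, fun h => ?_⟩
          · exact mem_class_of_rel hH h
              (hS.greenH_lmul_rmul hxf (rel_of_mem_class hH x.2 h).1.1.leJ)
          · exact mem_class_of_rel hH h (hS.greenH_lmul_rmul ((greenH S).symm' hxf)
              (rel_of_mem_class hH (f.1 x).2 h).1.1.leJ)
        refine ⟨hHJ x.2, hHJ (f.1 x).2, hxf, hiff, fun s t h => ?_⟩
        -- If `x ↦ s x t` acts as `g` after the left translation by `s`, then it carries the pair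
        -- `x`, `f x` to a pair related by the conjugate of `f` by `g`.
        obtain ⟨hsx, g, hg, hgs⟩ := exists_schutzenberger_lmul_rmul hH hS x.2 h
        obtain ⟨hsf, -⟩ := exists_schutzenberger_lmul_rmul hH hS (f.1 x).2 ((hiff s t).1 h)
        let g' : schutzenbergerGroup H hH := ⟨g, hg⟩
        refine ⟨g' * f * g'⁻¹, N.2.conj_mem f hf g', ?_⟩
        have e1 : (⟨_, h⟩ : H) = g ⟨_, hsx⟩ := Subtype.ext (hgs x hsx)
        have e2 : (⟨_, hsf⟩ : H) = f.1 ⟨_, hsx⟩ :=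
          Subtype.ext (schutzenberger_lmul hH f.2 (x := x) rfl).symm
        rw [hgs _ hsf, e1, e2]
        have e3 : (g' * f * g'⁻¹).1 (g ⟨_, hsx⟩) = g (f.1 (g⁻¹ (g ⟨_, hsx⟩))) := rfl
        rw [e3, show g⁻¹ (g ⟨_, hsx⟩) = ⟨_, hsx⟩ from g.symm_apply_apply _])

end Green

/-! ### Principal factors and the sum formula -/

section PrincipalFactor

variable {S : Type u} [Semigroup S] {J : Set S}

theorem principalFactorOp_some_of_mem {i : S ⊕ S} {a : J} (h : biactOp S i a ∈ J) :
    principalFactorOp (biactOp S) J i (some a) = some ⟨_, h⟩ := by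
  simp [principalFactorOp, h]

theorem principalFactorOp_some_of_notMem {i : S ⊕ S} {a : J} (h : biactOp S i a ∉ J) :
    principalFactorOp (biactOp S) J i (some a) = none := by
  simp [principalFactorOp, h]

theorem IsStable.greenH_biactOp (hS : IsStable S) (hJ : J ∈ (greenJ S).classes) {a b : S}
    (ha : a ∈ J) (hab : greenH S a b) {i : S ⊕ S} (h : biactOp S i a ∈ J) :
    biactOp S i b ∈ J ∧ greenH S (biactOp S i a) (biactOp S i b) := by
  have hle := (rel_of_mem_class hJ ha h).1
  have hH : greenH S (biactOp S i a) (biactOp S i b) := by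
    rcases i with s | t
    · exact (hS.greenH_lmul (s := (s : WithOne S)) hab hle).2
    · exact (hS.greenH_rmul (t := (t : WithOne S)) hab hle).2
  exact ⟨mem_class_of_rel hJ h (greenL_le_greenJ hH.1), hH⟩

theorem extendZero_mem_unaryCong (hS : IsStable S) (hJ : J ∈ (greenJ S).classes) {σ : Setoid J}
    (hσ : σ ∈ congBelowH J) :
    extendZero σ ∈ unaryCong (principalFactorOp (biactOp S) J) := by
  rintro i _ _ (h | _)
  · rename_i a b
    by_cases ha : biactOp S i a ∈ J
    · have hb := (hS.greenH_biactOp hJ a.2 (hσ.1 h) ha).1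
      rw [principalFactorOp_some_of_mem ha, principalFactorOp_some_of_mem hb]
      exact .some (hσ.2 i a b h ha hb)
    · have hb : biactOp S i b ∉ J := fun hb =>
        ha (hS.greenH_biactOp hJ b.2 ((greenH S).symm' (hσ.1 h)) hb).1
      rw [principalFactorOp_some_of_notMem ha, principalFactorOp_some_of_notMem hb]
  · exact .none

theorem restrictH_mem_congBelowH (hS : IsStable S) (hJ : J ∈ (greenJ S).classes) :
    restrictH J ∈ congBelowH J :=
  ⟨le_rfl, fun _ a _ h ha _ => (hS.greenH_biactOp hJ a.2 h ha).2⟩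

/-- A congruence of a principal factor that relates `0` to a nonzero element is universal, since
every element of a `J`-class generates the class. -/
theorem eq_top_of_rel_zero (hJ : J ∈ (greenJ S).classes) {σ : Setoid (Option J)}
    (hσ : σ ∈ unaryCong (principalFactorOp (biactOp S) J)) {y : J} (h : σ none (some y)) :
    σ = ⊤ := by
  have hl : ∀ (s : WithOne S) (x : J) (hx : lmul s (x : S) ∈ J), σ none (some x) →
      σ none (some ⟨_, hx⟩) := by
    intro s x hx hσx
    induction s using WithOne.recOneCoe with
    | one => exact hσx
    | coe s =>
      have := hσ (.inl s) _ _ hσx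
      rwa [principalFactorOp_some_of_mem (i := .inl s) hx] at this
  have hr : ∀ (t : WithOne S) (x : J) (hx : rmul (x : S) t ∈ J), σ none (some x) →
      σ none (some ⟨_, hx⟩) := by
    intro t x hx hσx
    induction t using WithOne.recOneCoe with
    | one => exact hσx
    | coe t =>
      have := hσ (.inr t) _ _ hσx
      rwa [principalFactorOp_some_of_mem (i := .inr t) hx] at this
  have key : ∀ z, σ none z := by
    rintro (_ | ⟨z, hz⟩)
    · exact σ.refl' _
    · have hzy := rel_of_mem_class hJ hz y.2
      obtain ⟨s, t, rfl⟩ := hzy.1.exists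
      have hyt : rmul (y : S) t ∈ J :=
        mem_class_of_rel hJ y.2 ⟨(leJ_of_lmul_rmul hzy.2).2, (leR_rmul _ _).leJ⟩
      exact hl s ⟨_, hyt⟩ hz (hr t y hyt h)
  exact Setoid.ext fun a b => ⟨fun _ => trivial, fun _ => σ.trans' (σ.symm' (key a)) (key b)⟩

/-- In an `H`-separable principal factor not only the maximal, but all proper congruences lie below
`H`: by maximality of `H`, the join of `H` and a congruence `σ` outside of it is universal, and this
forces `σ` to relate `0` to a nonzero element. -/
theorem IsHSeparable.le_of_ne_top (hJ : J ∈ (greenJ S).classes)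
    (hsep : IsHSeparable J) {σ : Setoid (Option J)}
    (hσ : σ ∈ unaryCong (principalFactorOp (biactOp S) J)) (hne : σ ≠ ⊤) :
    σ ≤ extendZero (restrictH J) := by
  have hmax := hsep.maximal
  by_contra hle
  have htop : σ ⊔ extendZero (restrictH J) = ⊤ := by
    by_contra h
    exact hle (le_sup_left.trans (hmax.2 ⟨sup_mem_unaryCong hσ hmax.1.1, h⟩ le_sup_right))
  by_cases h0 : ∃ y : J, σ none (some y)
  · obtain ⟨y, hy⟩ := h0
    exact hne (eq_top_of_rel_zero hJ hσ hy)
  · push Not at h0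
    have h1 : σ ⊔ extendZero (restrictH J) ≤ extendZero ⊤ := by
      refine sup_le ?_ ?_
      · rintro (_ | a) (_ | b) h
        · exact .none
        · exact (h0 b h).elim
        · exact (h0 a (σ.symm' h)).elim
        · exact .some trivial
      · rintro _ _ (h | _)
        · exact .some trivial
        · exact .none
    rw [htop] at h1
    obtain ⟨y, hy⟩ := exists_mem_of_mem_classes hJ
    have h2 : extendZero (⊤ : Setoid J) none (some ⟨y, hy⟩) := h1 trivial
    cases h2

theorem height_principalFactor (hS : IsStable S) (hJ : J ∈ (greenJ S).classes)
    (hsep : IsHSeparable J) :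
    height (unaryCong (principalFactorOp (biactOp S) J)) = height (congBelowH J) + 1 := by
  have hmax := hsep.maximal
  refine le_antisymm ?_ ?_
  · refine height_le_add_one
      (f := fun σ => ⟨σ.1.comap some ⊓ restrictH J, inf_le_right, fun i a b h ha hb => ?_⟩)
      (p := fun σ => σ.1 = ⊤) ?_ ?_ ?_
    · have h1 := σ.2 i _ _ h.1
      rw [principalFactorOp_some_of_mem ha, principalFactorOp_some_of_mem hb] at h1
      exact ⟨h1, (restrictH_mem_congBelowH hS hJ).2 i a b h.2 ha hb⟩
    · exact fun σ τ h a b hab => ⟨h hab.1, hab.2⟩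
    · exact fun σ τ h hσ => top_le_iff.1 (hσ ▸ h)
    · intro σ τ hle h1 h2
      by_cases hτ : τ.1 = ⊤
      · exact Subtype.ext ((h2.2 hτ).trans hτ.symm)
      · refine le_antisymm hle fun a b hab => ?_
        have h1 : σ.1.comap some ⊓ restrictH J = τ.1.comap some ⊓ restrictH J :=
          congrArg Subtype.val h1
        rcases hsep.le_of_ne_top hJ τ.2 hτ hab with h | _
        · rename_i a b
          have h3 : (τ.1.comap some ⊓ restrictH J) a b := ⟨hab, h⟩
          rw [← h1] at h3
          exact h3.1
        · exact σ.1.refl' _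
  · let f : congBelowH J ↪o unaryCong (principalFactorOp (biactOp S) J) :=
      OrderEmbedding.ofMapLEIff (fun σ => ⟨extendZero σ.1, extendZero_mem_unaryCong hS hJ σ.2⟩) (by
        refine fun σ τ => ⟨fun h a b hab => ?_, ?_⟩
        · have h1 : extendZero τ.1 (some a) (some b) := h (.some hab)
          cases h1 with
          | some h1 => exact h1
        · rintro h _ _ (k | _)
          · exact .some (h k)
          · exact .none)
    let m : unaryCong (principalFactorOp (biactOp S) J) := ⟨_, hmax.1.1⟩
    let t : unaryCong (principalFactorOp (biactOp S) J) := ⟨⊤, top_mem_unaryCong _⟩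
    have hmt : m ≠ t := fun h => hmax.1.2 (congrArg Subtype.val h)
    have hle : m ≤ t := fun _ _ _ => trivial
    have h := height_add_mk_le f (d := {m, t}) (IsChain.pair hle) (by
      have hm : ∀ σ, f σ ≤ m := by
        rintro σ _ _ (k | _)
        · exact .some (σ.2.1 k)
        · exact .none
      rintro σ y (rfl | rfl)
      · exact hm σ
      · exact (hm σ).trans hle)
    rw [Cardinal.mk_insert (by simpa using hmt), Cardinal.mk_singleton, ← add_assoc] at h
    exact Cardinal.add_one_le_add_one_iff.1 h

/-- Adding one `H`-separable `J`-class `J` to an ideal `X` adds the height of the lattice of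
congruences of `J` below `H`. -/
theorem height_union (hS : IsStable S) (hJ : J ∈ (greenJ S).classes) (hsep : IsHSeparable J)
    {X Y : Set S} (hX : ∀ (i : S ⊕ S) (a : S), a ∈ X → biactOp S i a ∈ X)
    (hY : ∀ (i : S ⊕ S) (a : S), a ∈ Y → biactOp S i a ∈ Y) (hne : X.Nonempty)
    (hXY : Y = X ∪ J) (hd : Disjoint X J) :
    height (unaryCong (subOp (biactOp S) Y hY)) =
      height (unaryCong (subOp (biactOp S) X hX)) + height (congBelowH J) := by
  classical
  have hXsub : X ⊆ Y := hXY ▸ Set.subset_union_left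
  have hJsub : J ⊆ Y := hXY ▸ Set.subset_union_right
  have hXJ : ∀ x ∈ X, x ∉ J := fun x hx hxJ => Set.disjoint_left.1 hd hx hxJ
  have hcase : ∀ y : Y, (y : S) ∉ J → (y : S) ∈ X := fun y hy => by
    have h : (y : S) ∈ X ∪ J := hXY.subset y.2
    exact h.resolve_right hy
  let φ : Y → Option J := fun y => if h : (y : S) ∈ J then some ⟨y, h⟩ else none
  have φ_pos : ∀ (y : Y) (h : (y : S) ∈ J), φ y = some ⟨y, h⟩ := fun y h => dif_pos h
  have φ_neg : ∀ y : Y, (y : S) ∉ J → φ y = none := fun y h => dif_neg h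
  obtain ⟨x₀, hx₀⟩ := hne
  have : Nonempty X := ⟨⟨x₀, hx₀⟩⟩
  have key := height_unaryCong_extension (opX := subOp (biactOp S) X hX)
    (op := subOp (biactOp S) Y hY) (opB := principalFactorOp (biactOp S) J)
    (Set.inclusion hXsub) (Set.inclusion_injective hXsub) (fun _ _ => rfl) φ ?_ ?_ ?_
  · rw [height_principalFactor hS hJ hsep, ← add_assoc] at key
    exact Cardinal.add_one_inj.1 key
  · rintro (_ | z)
    · exact ⟨⟨x₀, hXsub hx₀⟩, φ_neg _ (hXJ _ hx₀)⟩
    · exact ⟨⟨z, hJsub z.2⟩, φ_pos _ z.2⟩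
  · intro s y
    by_cases hy : (y : S) ∈ J
    · rw [φ_pos y hy]
      by_cases hsy : biactOp S s y ∈ J
      · rw [principalFactorOp_some_of_mem hsy]
        exact φ_pos _ hsy
      · rw [principalFactorOp_some_of_notMem hsy]
        exact φ_neg _ hsy
    · rw [φ_neg y hy]
      exact φ_neg _ (hXJ _ (hX s _ (hcase y hy)))
  · intro a b
    constructor
    · intro h
      by_cases ha : (a : S) ∈ J
      · by_cases hb : (b : S) ∈ J
        · rw [φ_pos a ha, φ_pos b hb, Option.some_inj] at h
          exact .inl (Subtype.ext (congrArg (fun z : J => (z : S)) h))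
        · rw [φ_pos a ha, φ_neg b hb] at h
          cases h
      · by_cases hb : (b : S) ∈ J
        · rw [φ_neg a ha, φ_pos b hb] at h
          cases h
        · exact .inr ⟨⟨⟨a, hcase a ha⟩, rfl⟩, ⟨⟨b, hcase b hb⟩, rfl⟩⟩
    · rintro (rfl | ⟨⟨x, rfl⟩, ⟨y, rfl⟩⟩)
      · rfl
      · rw [φ_neg _ (hXJ _ x.2), φ_neg _ (hXJ _ y.2)]

theorem leJ_biactOp (i : S ⊕ S) (x : S) : LeJ (biactOp S i x) x := by
  rcases i with s | s
  · exact (leL_lmul (s : WithOne S) x).leJ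
  · exact (leR_rmul x (s : WithOne S)).leJ

/-- The sum formula for an ideal that is the union of the minimal ideal and finitely many
`H`-separable `J`-classes. -/
theorem height_biUnion (hS : IsStable S) {κ : Type} [DecidableEq κ] (J : κ → Set S) (r₀ : κ)
    (hJinj : Function.Injective J) (hJ : ∀ r, J r ∈ (greenJ S).classes)
    (hmin : IsMinimalJClass (J r₀)) (hsep : ∀ r, r ≠ r₀ → IsHSeparable (J r)) (T : Finset κ) :
    r₀ ∉ T → ∀ (X : Set S) (_ : X = J r₀ ∪ ⋃ r ∈ T, J r)
      (hX : ∀ (i : S ⊕ S) (a : S), a ∈ X → biactOp S i a ∈ X),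
      height (unaryCong (subOp (biactOp S) X hX)) =
        height (unaryCong (subOp (biactOp S) (J r₀) hmin.closed)) +
          ∑ r ∈ T, height (congBelowH (J r)) := by
  have hdisj : ∀ r s x, x ∈ J r → x ∈ J s → r = s := fun r s x hr hs =>
    hJinj (Setoid.eq_of_mem_classes (hJ r) hr (hJ s) hs)
  induction T using Finset.strongInduction with
  | H T ih =>
    intro h0 X hXT hX
    rcases T.eq_empty_or_nonempty with rfl | hne
    · have hX0 : X = J r₀ := by simpa using hXT
      subst hX0
      simp
    · choose x hx using fun r => exists_mem_of_mem_classes (hJ r)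
      let _ : Preorder S := { le := LeJ, le_refl := LeJ.refl, le_trans := fun _ _ _ => LeJ.trans }
      -- Remove a class that is maximal among those in `T`: what remains is still an ideal.
      obtain ⟨r, hr⟩ := T.exists_maximalFor x hne
      have hr0 : r ≠ r₀ := fun h => h0 (h ▸ hr.1)
      have hcl : ∀ (i : S ⊕ S) (a : S), a ∈ J r₀ ∪ ⋃ s ∈ T.erase r, J s →
          biactOp S i a ∈ J r₀ ∪ ⋃ s ∈ T.erase r, J s := by
        rintro i a (ha | ha)
        · exact .inl (hmin.closed i a ha)
        · obtain ⟨s, hs, has⟩ := Set.mem_iUnion₂.1 ha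
          have hsT := Finset.mem_erase.1 hs
          have haX : a ∈ X := hXT ▸ Or.inr (Set.mem_iUnion₂.2 ⟨s, hsT.2, has⟩)
          have h1 := hX i a haX
          rw [hXT] at h1
          rcases h1 with h1 | h1
          · exact .inl h1
          · obtain ⟨q, hq, haq⟩ := Set.mem_iUnion₂.1 h1
            refine .inr (Set.mem_iUnion₂.2 ⟨q, Finset.mem_erase.2 ⟨?_, hq⟩, haq⟩)
            rintro rfl
            have h2 : LeJ (x q) (x s) := (rel_of_mem_class (hJ q) (hx q) haq).1.trans
              ((leJ_biactOp i a).trans (rel_of_mem_class (hJ s) has (hx s)).1)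
            have h3 : LeJ (x s) (x q) := hr.2 hsT.2 h2
            exact hsT.1 (hdisj s q (x s) (hx s) (mem_class_of_rel (hJ q) (hx q) ⟨h2, h3⟩))
      have hXr : X = (J r₀ ∪ ⋃ s ∈ T.erase r, J s) ∪ J r := by
        rw [hXT, ← Finset.insert_erase hr.1, Finset.set_biUnion_insert,
          Finset.erase_insert_eq_erase, Finset.erase_idem, Set.union_assoc, Set.union_comm (J r)]
      have hd : Disjoint (J r₀ ∪ ⋃ s ∈ T.erase r, J s) (J r) := by
        refine Set.disjoint_left.2 ?_
        rintro a (ha | ha) har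
        · exact hr0 (hdisj _ _ a har ha)
        · obtain ⟨s, hs, has⟩ := Set.mem_iUnion₂.1 ha
          exact (Finset.mem_erase.1 hs).1 (hdisj _ _ a has har)
      rw [height_union hS (hJ r) (hsep r hr0) hcl hX ⟨x r₀, .inl (hx r₀)⟩ hXr hd,
        ih _ (Finset.erase_ssubset hr.1) (fun h => h0 (Finset.mem_of_mem_erase h)) _ rfl hcl,
        add_assoc, Finset.sum_erase_add _ _ hr.1]

/-- Semigroup congruences are the congruences of the biact. -/
def conOrderIso (h : ∀ (i : S ⊕ S) (a : S), a ∈ Set.univ → biactOp S i a ∈ Set.univ) :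
    Con S ≃o unaryCong (subOp (biactOp S) Set.univ h) where
  toFun c := ⟨c.toSetoid.comap Subtype.val, by
    rintro (s | s) a b hab
    · exact c.mul (c.refl s) hab
    · exact c.mul hab (c.refl s)⟩
  invFun σ :=
    { r x y := σ.1 ⟨x, trivial⟩ ⟨y, trivial⟩
      iseqv := ⟨fun _ => σ.1.refl' _, fun h => σ.1.symm' h, fun h k => σ.1.trans' h k⟩
      mul' := fun {a b c d} hab hcd =>
        σ.1.trans' (σ.2 (.inr c) _ _ hab) (σ.2 (.inl b) _ _ hcd) }
  left_inv _ := rfl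
  right_inv _ := rfl
  map_rel_iff' {c d} := ⟨fun h x y hxy => h (x := ⟨x, trivial⟩) (y := ⟨y, trivial⟩) hxy,
    fun h _ _ hxy => h hxy⟩

theorem height_con (hS : IsStable S) (n : ℕ) (J : Fin (n + 1) → Set S)
    (hJinj : Function.Injective J) (hJrange : Set.range J = (greenJ S).classes)
    (hmin : IsMinimalJClass (J 0)) (hsep : ∀ r : Fin (n + 1), r ≠ 0 → IsHSeparable (J r)) :
    height (Con S) = height (unaryCong (subOp (biactOp S) (J 0) hmin.closed)) +
      ∑ r : Fin n, height (congBelowH (J r.succ)) := by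
  have huniv : Set.univ =
      J 0 ∪ ⋃ r ∈ Finset.univ.map ⟨Fin.succ, Fin.succ_injective n⟩, J r := by
    refine (Set.eq_univ_of_forall fun x => ?_).symm
    obtain ⟨r, hr⟩ : {y | greenJ S y x} ∈ Set.range J := hJrange ▸ Setoid.mem_classes _ x
    have hx : x ∈ J r := hr ▸ (greenJ S).refl' x
    rcases Fin.eq_zero_or_eq_succ r with rfl | ⟨s, rfl⟩
    · exact .inl hx
    · exact .inr (Set.mem_iUnion₂.2 ⟨s.succ, by simp, hx⟩)
  rw [height_congr (conOrderIso fun _ _ _ => Set.mem_univ _),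
    height_biUnion hS J 0 hJinj (fun r => hJrange ▸ ⟨r, rfl⟩) hmin hsep _
      (by simp [Fin.succ_ne_zero]) Set.univ huniv, Finset.sum_map]
  rfl

end PrincipalFactor

/-! ### The minimal ideal -/

section Minimal

variable {S : Type u} [Semigroup S] {J : Set S}

theorem IsMinimalJClass.lmul_mem (hJ : IsMinimalJClass J) {x : S} (hx : x ∈ J) (s : WithOne S) :
    lmul s x ∈ J :=
  hJ.2 x hx _ (leL_lmul s x).leJ

theorem IsMinimalJClass.rmul_mem (hJ : IsMinimalJClass J) {x : S} (hx : x ∈ J) (t : WithOne S) :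
    rmul x t ∈ J :=
  hJ.2 x hx _ (leR_rmul x t).leJ

theorem IsMinimalJClass.greenL_lmul (hJ : IsMinimalJClass J) (hS : IsStable S) {x : S}
    (hx : x ∈ J) (s : WithOne S) : greenL S x (lmul s x) :=
  hS.greenL_lmul (rel_of_mem_class hJ.1 hx (hJ.lmul_mem hx s)).1

theorem IsMinimalJClass.greenR_rmul (hJ : IsMinimalJClass J) (hS : IsStable S) {x : S}
    (hx : x ∈ J) (t : WithOne S) : greenR S x (rmul x t) :=
  hS.greenR_rmul (rel_of_mem_class hJ.1 hx (hJ.rmul_mem hx t)).1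

/-- Stable minimal `J`-classes are regular. -/
theorem IsMinimalJClass.exists_regular (hJ : IsMinimalJClass J) (hS : IsStable S) {x : S}
    (hx : x ∈ J) : ∃ w : WithOne S, (x : WithOne S) * w * x = x := by
  obtain ⟨u, hu⟩ := (hJ.greenR_rmul hS hx x).1
  obtain ⟨v, hv⟩ := (hJ.greenL_lmul hS hx x).1
  rw [coe_rmul] at hu
  rw [coe_lmul] at hv
  refine ⟨u, ?_⟩
  calc (x : WithOne S) * u * x = v * (x * x) * u * x := by rw [← hv]
    _ = v * ((x * x * u) * x) := by simp only [mul_assoc]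
    _ = x := by rw [← hu, ← hv]

theorem RelOn.lmul_of_mem (hJ : IsMinimalJClass J) {σ : Setoid J}
    (hσ : σ ∈ unaryCong (subOp (biactOp S) J hJ.closed)) {a b : S} (h : RelOn σ a b)
    (s : WithOne S) : RelOn σ (GreenHeight.lmul s a) (GreenHeight.lmul s b) := by
  refine ⟨hJ.lmul_mem h.1 s, hJ.lmul_mem h.2.1 s, ?_⟩
  obtain ⟨ha, hb, h⟩ := h
  induction s using WithOne.recOneCoe with
  | one => exact h
  | coe s => exact hσ (.inl s) _ _ h

theorem RelOn.rmul_of_mem (hJ : IsMinimalJClass J) {σ : Setoid J}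
    (hσ : σ ∈ unaryCong (subOp (biactOp S) J hJ.closed)) {a b : S} (h : RelOn σ a b)
    (t : WithOne S) : RelOn σ (GreenHeight.rmul a t) (GreenHeight.rmul b t) := by
  refine ⟨hJ.rmul_mem h.1 t, hJ.rmul_mem h.2.1 t, ?_⟩
  obtain ⟨ha, hb, h⟩ := h
  induction t using WithOne.recOneCoe with
  | one => exact h
  | coe t => exact hσ (.inr t) _ _ h

/-- A congruence commutes with `H` on an `L`-class of the minimal ideal. -/
theorem exists_relOn_greenH_of_greenL (hJ : IsMinimalJClass J) (hS : IsStable S) {σ : Setoid J}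
    (hσ : σ ∈ unaryCong (subOp (biactOp S) J hJ.closed)) {b c d : S} (hcb : greenH S c b)
    (h : RelOn σ b d) (hbd : greenL S b d) : ∃ d', RelOn σ c d' ∧ greenH S d' d := by
  obtain ⟨w, rfl⟩ := leR_iff.1 hcb.2.1
  refine ⟨_, h.rmul_of_mem hJ hσ w, ?_, (greenR S).symm' (hJ.greenR_rmul hS h.2.1 w)⟩
  exact (greenL S).trans' ((greenL S).symm' (greenL_rmul hbd w)) ((greenL S).trans' hcb.1 hbd)

/-- A congruence commutes with `H` on an `R`-class of the minimal ideal. -/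
theorem exists_relOn_greenH_of_greenR (hJ : IsMinimalJClass J) (hS : IsStable S) {σ : Setoid J}
    (hσ : σ ∈ unaryCong (subOp (biactOp S) J hJ.closed)) {b c d : S} (hcb : greenH S c b)
    (h : RelOn σ b d) (hbd : greenR S b d) : ∃ d', RelOn σ c d' ∧ greenH S d' d := by
  obtain ⟨w, rfl⟩ := leL_iff.1 hcb.1.1
  refine ⟨_, h.lmul_of_mem hJ hσ w, (greenL S).symm' (hJ.greenL_lmul hS h.2.1 w), ?_⟩
  exact (greenR S).trans' ((greenR S).symm' (greenR_lmul hbd w)) ((greenR S).trans' hcb.2 hbd)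

/-- The product of a congruence with `H`, on a subset `X` of `J` on which the two commute. -/
def mulH (σ : Setoid J) (X : Set S) (hX : X ⊆ J)
    (hcomm : ∀ b ∈ X, ∀ d ∈ X, ∀ c, greenH S c b → RelOn σ b d →
      ∃ d', RelOn σ c d' ∧ greenH S d' d)
    (hcl : ∀ a ∈ X, ∀ b, greenH S a b → b ∈ X) : Setoid X where
  r a b := ∃ c, RelOn σ (a : S) c ∧ greenH S c b
  iseqv :=
    { refl := fun a => ⟨a, .refl σ (hX a.2), (greenH S).refl' _⟩
      symm := by
        rintro a b ⟨c, h, k⟩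
        exact hcomm c (hcl b b.2 c ((greenH S).symm' k)) a a.2 b ((greenH S).symm' k) h.symm
      trans := by
        rintro a b e ⟨c, h, k⟩ ⟨d, l, m⟩
        obtain ⟨d', hd, hd'⟩ := hcomm b b.2 d (hcl e e.2 d ((greenH S).symm' m)) c k l
        exact ⟨d', h.trans hd, (greenH S).trans' hd' m⟩ }

/-- The product of a congruence of the minimal ideal with `H`, on an `L`-class. -/
def mulHL (hJ : IsMinimalJClass J) (hS : IsStable S) {L : Set S} (hL : L ∈ (greenL S).classes)
    (hLJ : L ⊆ J) (σ : unaryCong (subOp (biactOp S) J hJ.closed)) : Setoid L :=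
  mulH σ.1 L hLJ (fun _ hb _ hd _ h k =>
      exists_relOn_greenH_of_greenL hJ hS σ.2 h k (rel_of_mem_class hL hb hd))
    fun _ ha _ h => mem_class_of_rel hL ha h.1

/-- The product of a congruence of the minimal ideal with `H`, on an `R`-class. -/
def mulHR (hJ : IsMinimalJClass J) (hS : IsStable S) {R : Set S} (hR : R ∈ (greenR S).classes)
    (hRJ : R ⊆ J) (σ : unaryCong (subOp (biactOp S) J hJ.closed)) : Setoid R :=
  mulH σ.1 R hRJ (fun _ hb _ hd _ h k =>
      exists_relOn_greenH_of_greenR hJ hS σ.2 h k (rel_of_mem_class hR hb hd))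
    fun _ ha _ h => mem_class_of_rel hR ha h.2

section

variable (hJ : IsMinimalJClass J) (hS : IsStable S) {L R : Set S} (hL : L ∈ (greenL S).classes)
  (hLJ : L ⊆ J) (hR : R ∈ (greenR S).classes) (hRJ : R ⊆ J)

theorem mulHL_mono : Monotone (mulHL hJ hS hL hLJ) :=
  fun _ _ h _ _ ⟨c, ⟨ha, hc, k⟩, l⟩ => ⟨c, ⟨ha, hc, h k⟩, l⟩

theorem mulHR_mono : Monotone (mulHR hJ hS hR hRJ) :=
  fun _ _ h _ _ ⟨c, ⟨ha, hc, k⟩, l⟩ => ⟨c, ⟨ha, hc, h k⟩, l⟩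

theorem restrictH_le_mulHL (σ : unaryCong (subOp (biactOp S) J hJ.closed)) :
    restrictH L ≤ mulHL hJ hS hL hLJ σ :=
  fun a _ h => ⟨a, .refl _ (hLJ a.2), h⟩

theorem restrictH_le_mulHR (σ : unaryCong (subOp (biactOp S) J hJ.closed)) :
    restrictH R ≤ mulHR hJ hS hR hRJ σ :=
  fun a _ h => ⟨a, .refl _ (hRJ a.2), h⟩

theorem mulHL_eq_top_or (hmax : IsUniqueMaximalCong (subOp (leftOp S) L
      (hJ.leftClosed hS hL hLJ)) (restrictH L) ∨ restrictH L = ⊤)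
    (σ : unaryCong (subOp (biactOp S) J hJ.closed)) :
    mulHL hJ hS hL hLJ σ = ⊤ ∨ mulHL hJ hS hL hLJ σ = restrictH L := by
  have hle := restrictH_le_mulHL hJ hS hL hLJ σ
  rcases hmax with hmax | htop
  · by_cases h : mulHL hJ hS hL hLJ σ = ⊤
    · exact .inl h
    · refine .inr (le_antisymm (hmax.maximal.2 ⟨?_, h⟩ hle) hle)
      rintro s a b ⟨c, h, k⟩
      refine ⟨lmul s c, h.lmul_of_mem hJ σ.2 s, ?_⟩
      exact (hS.greenH_lmul k (hJ.greenL_lmul hS h.2.1 s).1.leJ).2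
  · exact .inl (top_le_iff.1 (htop ▸ hle))

theorem mulHR_eq_top_or (hmax : IsUniqueMaximalCong (subOp (rightOp S) R
      (hJ.rightClosed hS hR hRJ)) (restrictH R) ∨ restrictH R = ⊤)
    (σ : unaryCong (subOp (biactOp S) J hJ.closed)) :
    mulHR hJ hS hR hRJ σ = ⊤ ∨ mulHR hJ hS hR hRJ σ = restrictH R := by
  have hle := restrictH_le_mulHR hJ hS hR hRJ σ
  rcases hmax with hmax | htop
  · by_cases h : mulHR hJ hS hR hRJ σ = ⊤
    · exact .inl h
    · refine .inr (le_antisymm (hmax.maximal.2 ⟨?_, h⟩ hle) hle)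
      rintro t a b ⟨c, h, k⟩
      refine ⟨rmul c t, h.rmul_of_mem hJ σ.2 t, ?_⟩
      exact (hS.greenH_rmul k (hJ.greenR_rmul hS h.2.1 t).1.leJ).2
  · exact .inl (top_le_iff.1 (htop ▸ hle))

include hJ hS hL hLJ in
theorem rmul_coe_mem {l : S} (hl : l ∈ L) (z : S) : rmul z (l : WithOne S) ∈ L :=
  mem_class_of_rel hL hl (hJ.greenL_lmul hS (hLJ hl) (z : WithOne S))

include hJ hS hR hRJ in
theorem lmul_coe_mem {l : S} (hl : l ∈ R) (z : S) : lmul (l : WithOne S) z ∈ R :=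
  mem_class_of_rel hR hl (hJ.greenR_rmul hS (hRJ hl) (z : WithOne S))

include hS hL hLJ in
/-- The products with `H` on one `L`-class already determine the congruence modulo `R`. -/
theorem exists_relOn_greenR {σ τ : unaryCong (subOp (biactOp S) J hJ.closed)}
    (h : mulHL hJ hS hL hLJ τ ≤ mulHL hJ hS hL hLJ σ) {x y : S} (hxy : RelOn τ.1 x y) :
    ∃ z, RelOn σ.1 x z ∧ greenR S z y := by
  obtain ⟨l, hl⟩ := exists_mem_of_mem_classes hL
  have hmem := rmul_coe_mem hJ hS hL hLJ hl
  obtain ⟨c, hc, hcy⟩ := h (x := ⟨rmul x l, hmem x⟩) (y := ⟨rmul y l, hmem y⟩)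
    ⟨rmul y l, hxy.rmul_of_mem hJ τ.2 l, (greenH S).refl' _⟩
  obtain ⟨u, hu⟩ := leR_iff.1 (hJ.greenR_rmul hS hxy.1 l).1
  have h1 := hc.rmul_of_mem hJ σ.2 u
  rw [hu] at h1
  refine ⟨_, h1, (greenR S).trans' ((greenR S).symm' (hJ.greenR_rmul hS hc.2.1 u)) ?_⟩
  exact (greenR S).trans' hcy.2 ((greenR S).symm' (hJ.greenR_rmul hS hxy.2.1 l))

include hS hR hRJ in
/-- The products with `H` on one `R`-class already determine the congruence modulo `L`. -/
theorem exists_relOn_greenL {σ τ : unaryCong (subOp (biactOp S) J hJ.closed)}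
    (h : mulHR hJ hS hR hRJ τ ≤ mulHR hJ hS hR hRJ σ) {x y : S} (hxy : RelOn τ.1 x y) :
    ∃ z, RelOn σ.1 x z ∧ greenL S z y := by
  obtain ⟨l, hl⟩ := exists_mem_of_mem_classes hR
  have hmem := lmul_coe_mem hJ hS hR hRJ hl
  obtain ⟨c, hc, hcy⟩ := h (x := ⟨lmul l x, hmem x⟩) (y := ⟨lmul l y, hmem y⟩)
    ⟨lmul l y, hxy.lmul_of_mem hJ τ.2 l, (greenH S).refl' _⟩
  obtain ⟨u, hu⟩ := leL_iff.1 (hJ.greenL_lmul hS hxy.1 l).1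
  have h1 := hc.lmul_of_mem hJ σ.2 u
  rw [hu] at h1
  refine ⟨_, h1, (greenL S).trans' ((greenL S).symm' (hJ.greenL_lmul hS hc.2.1 u)) ?_⟩
  exact (greenL S).trans' hcy.1 ((greenL S).symm' (hJ.greenL_lmul hS hxy.2.1 l))

/-- The trace of a congruence of the minimal ideal on `H`. -/
def infH (σ : unaryCong (subOp (biactOp S) J hJ.closed)) : congBelowH J :=
  ⟨σ.1 ⊓ restrictH J, inf_le_right, fun i a b h ha hb =>
    ⟨σ.2 i a b h.1, (restrictH_mem_congBelowH hS hJ.1).2 i a b h.2 ha hb⟩⟩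

theorem infH_mono : Monotone (infH hJ hS) := fun _ _ h _ _ k => ⟨h k.1, k.2⟩

/-- Among comparable congruences of the minimal ideal, a congruence is determined by its trace on
`H` and its products with `H` on one `L`-class and one `R`-class. Given `x τ y`, the products yield
`z` and `z'` that are `σ`-related to `x` and lie in the `R`-class and in the `L`-class of `y`. If
`x = x w x`, then `z w z'` is `σ`-related to `x` as well and lies in the `H`-class of `y`. -/
theorem eq_of_infH_eq {σ τ : unaryCong (subOp (biactOp S) J hJ.closed)} (hle : σ ≤ τ)
    (hH : infH hJ hS σ = infH hJ hS τ)
    (h₁ : mulHL hJ hS hL hLJ σ = mulHL hJ hS hL hLJ τ)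
    (h₂ : mulHR hJ hS hR hRJ σ = mulHR hJ hS hR hRJ τ) : σ = τ := by
  refine le_antisymm hle fun x y hxy => ?_
  obtain ⟨z, hxz, hzy⟩ := exists_relOn_greenR hJ hS hL hLJ h₁.ge (relOn_coe.2 hxy)
  obtain ⟨z', hxz', hzy'⟩ := exists_relOn_greenL hJ hS hR hRJ h₂.ge (relOn_coe.2 hxy)
  obtain ⟨w, hw⟩ := hJ.exists_regular hS x.2
  have e : lmul (((x : S) : WithOne S) * w) (x : S) = x := WithOne.coe_injective (by simpa using hw)
  have e1 : lmul (((x : S) : WithOne S) * w) z' = rmul (x : S) (w * z') :=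
    WithOne.coe_injective (by simp [mul_assoc])
  have e2 : lmul ((z : WithOne S) * w) z' = rmul z (w * z') :=
    WithOne.coe_injective (by simp [mul_assoc])
  have h3 := hxz'.lmul_of_mem hJ σ.2 (((x : S) : WithOne S) * w)
  rw [e, e1] at h3
  have h4 : RelOn σ.1 (x : S) (rmul z (w * z')) := h3.trans (hxz.rmul_of_mem hJ σ.2 (w * z'))
  have h5 : greenH S (rmul z (w * z')) y := by
    refine ⟨?_, (greenR S).trans' ((greenR S).symm' (hJ.greenR_rmul hS hxz.2.1 _)) hzy⟩
    rw [← e2]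
    exact (greenL S).trans' ((greenL S).symm' (hJ.greenL_lmul hS hxz'.2.1 _)) hzy'
  obtain ⟨hx, hz, h4⟩ := h4
  have hH' : σ.1 ⊓ restrictH J = τ.1 ⊓ restrictH J := congrArg Subtype.val hH
  have h6 : (τ.1 ⊓ restrictH J) ⟨_, hz⟩ y := ⟨τ.1.trans' (τ.1.symm' (hle h4)) hxy, h5⟩
  rw [← hH'] at h6
  exact σ.1.trans' h4 h6.1

include hJ hS hL hLJ in
theorem restrictH_eq_top_iff_greenR :
    restrictH L = ⊤ ↔ ∀ x ∈ J, ∀ y ∈ J, greenR S x y := by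
  constructor
  · intro h x hx y hy
    obtain ⟨l, hl⟩ := exists_mem_of_mem_classes hL
    have hmem := rmul_coe_mem hJ hS hL hLJ hl
    have h1 : restrictH L ⟨_, hmem x⟩ ⟨_, hmem y⟩ := h ▸ trivial
    exact (greenR S).trans' (hJ.greenR_rmul hS hx l)
      ((greenR S).trans' h1.2 ((greenR S).symm' (hJ.greenR_rmul hS hy l)))
  · exact fun h => top_le_iff.1 fun a b _ =>
      ⟨rel_of_mem_class hL a.2 b.2, h a (hLJ a.2) b (hLJ b.2)⟩

include hJ hS hR hRJ in
theorem restrictH_eq_top_iff_greenL :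
    restrictH R = ⊤ ↔ ∀ x ∈ J, ∀ y ∈ J, greenL S x y := by
  constructor
  · intro h x hx y hy
    obtain ⟨l, hl⟩ := exists_mem_of_mem_classes hR
    have hmem := lmul_coe_mem hJ hS hR hRJ hl
    have h1 : restrictH R ⟨_, hmem x⟩ ⟨_, hmem y⟩ := h ▸ trivial
    exact (greenL S).trans' (hJ.greenL_lmul hS hx l)
      ((greenL S).trans' h1.1 ((greenL S).symm' (hJ.greenL_lmul hS hy l)))
  · exact fun h => top_le_iff.1 fun a b _ =>
      ⟨h a (hRJ a.2) b (hRJ b.2), rel_of_mem_class hR a.2 b.2⟩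

/-- Congruences of `J` below `H`, as congruences of the biact `J`. -/
def congBelowHEmbedding : congBelowH J ↪o unaryCong (subOp (biactOp S) J hJ.closed) :=
  OrderEmbedding.ofMapLEIff (fun σ => ⟨σ.1, fun i a b h => σ.2.2 i a b h _ _⟩) fun _ _ => Iff.rfl

/-- Green's relation `R` as a congruence of the minimal ideal. -/
def congR : unaryCong (subOp (biactOp S) J hJ.closed) :=
  ⟨(greenR S).comap Subtype.val, by
    rintro (s | t) a b h
    · exact greenR_lmul h s
    · exact (greenR S).trans' ((greenR S).symm' (hJ.greenR_rmul hS a.2 t))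
        ((greenR S).trans' h (hJ.greenR_rmul hS b.2 t))⟩

/-- Chains of congruences below `H` can be prolonged by any chain of congruences starting at `H`. -/
theorem height_congBelowH_add_mk_le
    {d : Set (unaryCong (subOp (biactOp S) J hJ.closed))} (hd : IsChain (· ≤ ·) d)
    (hHd : ∀ σ ∈ d, restrictH J ≤ σ.1) :
    height (congBelowH J) + Cardinal.mk d ≤
      height (unaryCong (subOp (biactOp S) J hJ.closed)) + 1 :=
  height_add_mk_le (congBelowHEmbedding hJ) hd fun q σ hσ => q.2.1.trans (hHd σ hσ)

include hS in
theorem height_congBelowH_add_one_le (hne : restrictH J ≠ ⊤) :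
    height (congBelowH J) + 1 ≤ height (unaryCong (subOp (biactOp S) J hJ.closed)) := by
  let m := congBelowHEmbedding hJ ⟨_, restrictH_mem_congBelowH hS hJ.1⟩
  let t : unaryCong (subOp (biactOp S) J hJ.closed) := ⟨⊤, top_mem_unaryCong _⟩
  have hmt : m ≠ t := fun h => hne (congrArg Subtype.val h)
  have hle : m ≤ t := fun _ _ _ => trivial
  have h := height_congBelowH_add_mk_le hJ (d := {m, t}) (IsChain.pair hle) (by
    rintro y (rfl | rfl)
    · exact le_rfl
    · exact le_top)
  rw [Cardinal.mk_insert (by simpa using hmt), Cardinal.mk_singleton, ← add_assoc] at h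
  exact Cardinal.add_one_le_add_one_iff.1 h

include hS in
theorem height_congBelowH_add_two_le (hne : ¬ ∀ x ∈ J, ∀ y ∈ J, greenR S x y)
    (hne' : ¬ ∀ x ∈ J, ∀ y ∈ J, greenL S x y) :
    height (congBelowH J) + 2 ≤ height (unaryCong (subOp (biactOp S) J hJ.closed)) := by
  let m := congBelowHEmbedding hJ ⟨_, restrictH_mem_congBelowH hS hJ.1⟩
  let r := congR hJ hS
  let t : unaryCong (subOp (biactOp S) J hJ.closed) := ⟨⊤, top_mem_unaryCong _⟩
  have hrt : r ≠ t := fun h => hne fun x hx y hy => by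
    have h1 : t.1 ⟨x, hx⟩ ⟨y, hy⟩ := trivial
    rw [← h] at h1
    exact h1
  -- If `R` is contained in `L`, then `x L y x R y` gives `x L y` for all `x` and `y`.
  have hmr : m ≠ r := fun h => hne' fun x hx y hy => by
    have hyx : lmul x y ∈ J := hJ.lmul_mem hy x
    have h1 : r.1 ⟨x, hx⟩ ⟨_, hyx⟩ := hJ.greenR_rmul hS hx y
    rw [← h] at h1
    exact (greenL S).trans' h1.1 ((greenL S).symm' (hJ.greenL_lmul hS hy x))
  have hmr' : m ≤ r := fun _ _ h => h.2
  have hrt' : r ≤ t := fun _ _ _ => trivial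
  have hmt : m ≠ t := fun h => hrt (le_antisymm hrt' (h ▸ hmr'))
  have h := height_congBelowH_add_mk_le hJ (d := {m, r, t})
    ((IsChain.pair hrt').insert (by
      rintro y (rfl | rfl) _
      · exact .inl hmr'
      · exact .inl (hmr'.trans hrt'))) (by
    rintro y (rfl | rfl | rfl)
    · exact le_rfl
    · exact hmr'
    · exact le_top)
  rw [Cardinal.mk_insert (by simp [hmr, hmt]), Cardinal.mk_insert (by simpa using hrt),
    Cardinal.mk_singleton, ← add_assoc, one_add_one_eq_two] at h
  exact Cardinal.add_one_le_add_one_iff.1 h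

end

/-- The height of the congruence lattice of the minimal ideal, when the quotients by `H` of one
`L`-class and of one `R`-class are simple or trivial. -/
theorem height_minimal (hJ : IsMinimalJClass J) (hS : IsStable S) {L R : Set S}
    (hL : L ∈ (greenL S).classes) (hLJ : L ⊆ J) (hR : R ∈ (greenR S).classes) (hRJ : R ⊆ J)
    (hLmax : IsUniqueMaximalCong (subOp (leftOp S) L (hJ.leftClosed hS hL hLJ)) (restrictH L) ∨
      restrictH L = ⊤)
    (hRmax : IsUniqueMaximalCong (subOp (rightOp S) R (hJ.rightClosed hS hR hRJ)) (restrictH R) ∨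
      restrictH R = ⊤) :
    let k := height (unaryCong (subOp (biactOp S) J hJ.closed))
    (restrictH L = ⊤ → restrictH R = ⊤ → k = height (congBelowH J)) ∧
    (restrictH L = ⊤ → restrictH R ≠ ⊤ → k = height (congBelowH J) + 1) ∧
    (restrictH L ≠ ⊤ → restrictH R = ⊤ → k = height (congBelowH J) + 1) ∧
    (restrictH L ≠ ⊤ → restrictH R ≠ ⊤ → k = height (congBelowH J) + 2) := by
  intro k
  have iffL := restrictH_eq_top_iff_greenR hJ hS hL hLJ
  have iffR := restrictH_eq_top_iff_greenL hJ hS hR hRJ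
  have eqL : ∀ σ τ, (mulHL hJ hS hL hLJ σ = ⊤ ↔ mulHL hJ hS hL hLJ τ = ⊤) →
      mulHL hJ hS hL hLJ σ = mulHL hJ hS hL hLJ τ := by
    intro σ τ h
    by_cases h' : mulHL hJ hS hL hLJ σ = ⊤
    · rw [h', h.1 h']
    · rw [(mulHL_eq_top_or hJ hS hL hLJ hLmax σ).resolve_left h',
        (mulHL_eq_top_or hJ hS hL hLJ hLmax τ).resolve_left fun k => h' (h.2 k)]
  have eqR : ∀ σ τ, (mulHR hJ hS hR hRJ σ = ⊤ ↔ mulHR hJ hS hR hRJ τ = ⊤) →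
      mulHR hJ hS hR hRJ σ = mulHR hJ hS hR hRJ τ := by
    intro σ τ h
    by_cases h' : mulHR hJ hS hR hRJ σ = ⊤
    · rw [h', h.1 h']
    · rw [(mulHR_eq_top_or hJ hS hR hRJ hRmax σ).resolve_left h',
        (mulHR_eq_top_or hJ hS hR hRJ hRmax τ).resolve_left fun k => h' (h.2 k)]
  have monoL : Monotone fun σ => mulHL hJ hS hL hLJ σ = ⊤ :=
    fun σ τ h hσ => top_le_iff.1 (hσ ▸ mulHL_mono hJ hS hL hLJ h)
  have monoR : Monotone fun σ => mulHR hJ hS hR hRJ σ = ⊤ :=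
    fun σ τ h hσ => top_le_iff.1 (hσ ▸ mulHR_mono hJ hS hR hRJ h)
  have topL : restrictH L = ⊤ → ∀ σ, mulHL hJ hS hL hLJ σ = ⊤ := fun h σ =>
    top_le_iff.1 (h ▸ restrictH_le_mulHL hJ hS hL hLJ σ)
  have topR : restrictH R = ⊤ → ∀ σ, mulHR hJ hS hR hRJ σ = ⊤ := fun h σ =>
    top_le_iff.1 (h ▸ restrictH_le_mulHR hJ hS hR hRJ σ)
  refine ⟨fun h₁ h₂ => ?_, fun h₁ h₂ => le_antisymm ?_ ?_, fun h₁ h₂ => le_antisymm ?_ ?_,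
    fun h₁ h₂ => le_antisymm ?_ ?_⟩
  · refine le_antisymm (height_le_of_orderEmbedding (OrderEmbedding.ofMapLEIff (infH hJ hS)
      fun σ τ => ⟨fun h a b hab => ?_, fun h => infH_mono hJ hS h⟩))
      (height_le_of_orderEmbedding (congBelowHEmbedding hJ))
    exact (h (x := a) (y := b) ⟨hab, iffR.1 h₂ a a.2 b b.2, iffL.1 h₁ a a.2 b b.2⟩).1
  · exact height_le_add_one (infH_mono hJ hS) monoR fun σ τ hle e h =>
      eq_of_infH_eq hJ hS hL hLJ hR hRJ hle e ((topL h₁ σ).trans (topL h₁ τ).symm) (eqR σ τ h)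
  · refine height_congBelowH_add_one_le hJ hS fun h => h₂ (iffR.2 fun x hx y hy => ?_)
    have : restrictH J ⟨x, hx⟩ ⟨y, hy⟩ := h ▸ trivial
    exact this.1
  · exact height_le_add_one (infH_mono hJ hS) monoL fun σ τ hle e h =>
      eq_of_infH_eq hJ hS hL hLJ hR hRJ hle e (eqL σ τ h) ((topR h₂ σ).trans (topR h₂ τ).symm)
  · refine height_congBelowH_add_one_le hJ hS fun h => h₁ (iffL.2 fun x hx y hy => ?_)
    have : restrictH J ⟨x, hx⟩ ⟨y, hy⟩ := h ▸ trivial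
    exact this.2
  · have h3 : k ≤ height (congBelowH J × ULift.{u} Prop) + 1 :=
      height_le_add_one (f := fun σ => (infH hJ hS σ, ULift.up (mulHL hJ hS hL hLJ σ = ⊤)))
        (fun σ τ h => ⟨infH_mono hJ hS h, monoL h⟩) monoR fun σ τ hle e h =>
          eq_of_infH_eq hJ hS hL hLJ hR hRJ hle (congrArg Prod.fst e)
            (eqL σ τ (iff_of_eq (congrArg (fun z => z.2.down) e))) (eqR σ τ h)
    have : Nonempty (congBelowH J) := ⟨⟨_, restrictH_mem_congBelowH hS hJ.1⟩⟩
    have h4 : height (congBelowH J × ULift.{u} Prop) ≤ height (congBelowH J) + 1 :=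
      height_le_add_one (f := Prod.fst) (p := fun z => z.2.down) (fun _ _ h => h.1)
        (fun _ _ h => h.2) fun x y _ e h => Prod.ext e (ULift.ext _ _ (propext h))
    rw [← one_add_one_eq_two, ← add_assoc]
    exact h3.trans (by gcongr)
  · exact height_congBelowH_add_two_le hJ hS (fun h => h₁ (iffL.2 h)) fun h => h₂ (iffR.2 h)

end Minimal

end GreenHeight

theorem mainTheorem5 {S : Type u} [Semigroup S] (hS : IsStable S)
    (n : ℕ) (J : Fin (n + 1) → Set S)
    (hJinj : Function.Injective J) (hJrange : Set.range J = (greenJ S).classes)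
    (hmin : IsMinimalJClass (J 0))
    (hsep : ∀ r : Fin (n + 1), r ≠ 0 → IsHSeparable (J r))
    (H : Fin (n + 1) → Set S) (hH : ∀ r, H r ∈ (greenH S).classes) (hHJ : ∀ r, H r ⊆ J r) :
    (height (Con S) =
      height (unaryCong (subOp (biactOp S) (J 0) hmin.closed)) +
        ∑ r : Fin n, height (NSub (schutzenbergerGroup (H r.succ) (hH r.succ)))) ∧
    ((∃ (L : Set S) (hL : L ∈ (greenL S).classes) (hLJ : L ⊆ J 0),
        IsUniqueMaximalCong (subOp (leftOp S) L (hmin.leftClosed hS hL hLJ)) (restrictH L) ∨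
          restrictH L = ⊤) →
      (∃ (R : Set S) (hR : R ∈ (greenR S).classes) (hRJ : R ⊆ J 0),
        IsUniqueMaximalCong (subOp (rightOp S) R (hmin.rightClosed hS hR hRJ)) (restrictH R) ∨
          restrictH R = ⊤) →
      ∀ L ∈ (greenL S).classes, L ⊆ J 0 → ∀ R ∈ (greenR S).classes, R ⊆ J 0 →
        (restrictH L = ⊤ → restrictH R = ⊤ →
          height (Con S) = ∑ r, height (NSub (schutzenbergerGroup (H r) (hH r)))) ∧
        (restrictH L = ⊤ → restrictH R ≠ ⊤ →
          height (Con S) = (∑ r, height (NSub (schutzenbergerGroup (H r) (hH r)))) + 1) ∧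
        (restrictH L ≠ ⊤ → restrictH R = ⊤ →
          height (Con S) = (∑ r, height (NSub (schutzenbergerGroup (H r) (hH r)))) + 1) ∧
        (restrictH L ≠ ⊤ → restrictH R ≠ ⊤ →
          height (Con S) = (∑ r, height (NSub (schutzenbergerGroup (H r) (hH r)))) + 2)) := by
  have hJ : ∀ r, J r ∈ (greenJ S).classes := fun r => hJrange ▸ ⟨r, rfl⟩
  have hN : ∀ r, height (congBelowH (J r)) = height (NSub (schutzenbergerGroup (H r) (hH r))) :=
    fun r => height_congr (congBelowHOrderIso (hH r) hS (hJ r) (hHJ r))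
  have ha := height_con hS n J hJinj hJrange hmin hsep
  simp only [hN] at ha
  refine ⟨ha, ?_⟩
  rintro ⟨L', hL', hLJ', hLmax⟩ ⟨R', hR', hRJ', hRmax⟩ L hL hLJ R hR hRJ
  have iffL : restrictH L = ⊤ ↔ restrictH L' = ⊤ :=
    (restrictH_eq_top_iff_greenR hmin hS hL hLJ).trans
      (restrictH_eq_top_iff_greenR hmin hS hL' hLJ').symm
  have iffR : restrictH R = ⊤ ↔ restrictH R' = ⊤ :=
    (restrictH_eq_top_iff_greenL hmin hS hR hRJ).trans
      (restrictH_eq_top_iff_greenL hmin hS hR' hRJ').symm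
  have hb := height_minimal hmin hS hL' hLJ' hR' hRJ' hLmax hRmax
  simp only [hN] at hb
  rw [ha, Fin.sum_univ_succ, ne_eq, ne_eq, iffL, iffR]
  exact ⟨fun h k => by rw [hb.1 h k], fun h k => by rw [hb.2.1 h k, add_right_comm],
    fun h k => by rw [hb.2.2.1 h k, add_right_comm],
    fun h k => by rw [hb.2.2.2 h k, add_right_comm]⟩
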